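/- \textbf{Proposition (Distribution of the largest jump).} Let $\sigma\in(0,1)$ and $\beta,c,r>0$, and let $P_0$ be a diffuse probability measure on a Polish space $E$ (for instance the uniform distribution on $[0,1]$). \emph{Model.} Let $\Delta_0>\Delta_1>\cdots$ be the decreasingly ordered points of a Poisson point process on $(0,\infty)$ with intensity $\sigma s^{-1-\sigma}\,ds$. The largest point $\Delta_0$ has density $f_{\Delta_0}(s)=\sigma s^{-1-\sigma}e^{-s^{-\sigma}}\mathbf 1(s>0)$. For $t>0$, let $G_t$ be the conditional law of $(\Delta_n/\Delta_0)_{n\ge1}$ given $\Delta_0=t$. Let the tilted largest jump $\Delta_{0,h}$ be a random variable with density $h_{c,\beta}(s)f_{\Delta_0}(s)$, where $$h_{c,\beta}(s)=\frac{\beta^{c+1}}{\Gamma(c+1)}\,s^{-c\sigma}\exp\{-(\beta-1)s^{-\sigma}\}.$$ Given $\Delta_{0,h}=t$, let the rates $(\theta_n)_{n\ge1}$ have law $G_t$. Let the labels $\omega_1,\omega_2,\dots$ be i.i.d. with law $P_0$ and independent of $(\Delta_{0,h},(\theta_n)_n)$, and let $\Theta=\sum_n\theta_n\delta_{\omega_n}$.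 Given $\Delta_{0,h}$, $(\theta_n)_n$ and $(\omega_n)_n$, let the counts $A_{d,n}$, $d,n\ge1$, be independent with $$\Pr(A_{d,n}=x\mid\Theta)=\binom{x+r-1}{x}\theta_n^x(1-\theta_n)^r,\qquad x=0,1,2,\dots$$ For each day $d$ let $Z_d=\sum_n A_{d,n}\delta_{\omega_n}$, a random measure on $E$. For a number $D_0$ of days, the data are $Z_{1:D_0}=(Z_1,\dots,Z_{D_0})$, and $N_{D_0}$ is the number of points $x\in E$ such that $Z_d(\{x\})>0$ for some $d\le D_0$. \emph{Claim.} For every $D_0$, almost surely $N_{D_0}<\infty$, and the conditional law of $\Delta_{0,h}$ given $Z_{1:D_0}$ has a density $f$ with respect to Lebesgue measure which satisfies $$f(\eta)\;\propto\;\exp\bigl\{-\eta^{-\sigma}\,[\beta+\psi_0^{(D_0)}]\bigr\}\;\eta^{-\sigma(N_{D_0}+c+1)-1}\,\mathbf 1(\eta>0).$$ That is, $$\Delta_{0,h}^{-\sigma}\mid Z_{1:D_0}\ \sim\ \mathrm{Gamma}\bigl(N_{D_0}+c+1,\ \beta+\psi_0^{(D_0)}\bigr)$$ (shape, rate). Here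 $\psi_x^{(y)}=\sigma\,[B(rx+1,-\sigma)-B(r(x+y)+1,-\sigma)]$, with $B(a,b)=\Gamma(a)\Gamma(b)/\Gamma(a+b)$. -/

import Mathlib

open MeasureTheory ProbabilityTheory Set

open scoped ENNReal

noncomputable section

namespace SBSP

/-- A random measure `N` on `E`, defined on the probability space `(Ω, P)`, is a Poisson point
process with intensity `ν`: the counts of pairwise disjoint sets are independent, and the count
of `B` is Poisson with mean `ν B` (almost surely infinite when `ν B = ∞`). -/
structure IsPoissonProcess {Ω E : Type*} [MeasurableSpace Ω] [MeasurableSpace E]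
    (P : Measure Ω) (ν : Measure E) (N : Ω → Measure E) : Prop where
  measurable : Measurable N
  law_count : ∀ B : Set E, MeasurableSet B → ν B ≠ ∞ →
    P.map (fun ω => N ω B) = (poissonMeasure (ν B).toNNReal).map (fun n : ℕ => (n : ℝ≥0∞))
  count_top : ∀ B : Set E, MeasurableSet B → ν B = ∞ → ∀ᵐ ω ∂P, N ω B = ∞
  indep : ∀ (k : ℕ) (B : Fin k → Set E), (∀ i, MeasurableSet (B i)) →
    Pairwise (fun i j => Disjoint (B i) (B j)) → iIndepFun (fun i ω => N ω (B i)) P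

/-- The stable Lévy measure `ν(ds) = σ s ^ (-1-σ) 1(s > 0) ds`. -/
def stableLevy (σ : ℝ) : Measure ℝ :=
  (volume.restrict (Ioi 0)).withDensity (fun s => ENNReal.ofReal (σ * s ^ (-1 - σ)))

/-- `Δ 0 > Δ 1 > …` is the decreasing enumeration of the jumps of a `σ`-stable process, that is, of
the points of a Poisson point process with intensity `stableLevy σ`. -/
structure IsStableJumps {Ω : Type*} [MeasurableSpace Ω] (σ : ℝ) (P : Measure Ω)
    (Δ : ℕ → Ω → ℝ) : Prop where
  measurable : ∀ n, Measurable (Δ n)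
  decreasing : ∀ᵐ ω ∂P, StrictAnti (fun n => Δ n ω)
  poisson : IsPoissonProcess P (stableLevy σ)
    (fun ω => Measure.sum (fun n => Measure.dirac (Δ n ω)))

/-- Density of the largest jump of the `σ`-stable process. -/
def largestJumpDensity (σ s : ℝ) : ℝ :=
  if 0 < s then σ * s ^ (-1 - σ) * Real.exp (-s ^ (-σ)) else 0

/-- The tilting function `h_{c,β}`. -/
def tilt (σ β c s : ℝ) : ℝ :=
  β ^ (c + 1) / Real.Gamma (c + 1) * s ^ (-c * σ) * Real.exp (-(β - 1) * s ^ (-σ))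

/-- Law of the tilted largest jump `Δ_{0,h}`: the density is `h_{c,β}(s) f_{Δ₀}(s)`. -/
def tiltedJumpLaw (σ β c : ℝ) : Measure ℝ :=
  volume.withDensity (fun s => ENNReal.ofReal (tilt σ β c s * largestJumpDensity σ s))

/-- `t ↦ G_t`, the conditional law of the sequence `(Δ (n+1) / Δ 0)_n` given `Δ 0 = t`. -/
def scaledJumpsKernel {Ω : Type*} [MeasurableSpace Ω] (P : Measure Ω) [IsFiniteMeasure P]
    (Δ : ℕ → Ω → ℝ) : Kernel ℝ (ℕ → ℝ) :=
  condDistrib (fun ω n => Δ (n + 1) ω / Δ 0 ω) (Δ 0) P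

/-- The negative binomial probability `binom(x+r-1, x) p ^ x (1-p) ^ r`. -/
def negBinProb (r p : ℝ) (x : ℕ) : ℝ :=
  Ring.choose ((x : ℝ) + r - 1) x * p ^ x * (1 - p) ^ r

open Classical in
/-- The negative binomial distribution with parameters `r > 0` and `p ∈ [0, 1)`. Outside of this
parameter range, where it is not defined, the value is set to a point mass. -/
def negBin (r p : ℝ) : Measure ℕ :=
  if 0 < r ∧ 0 ≤ p ∧ p < 1 then
    Measure.sum (fun x => ENNReal.ofReal (negBinProb r p x) • Measure.dirac x)
  else Measure.dirac 0

lemma negBinProb_nonneg {r p : ℝ} (hr : 0 < r) (h0 : 0 ≤ p) (h1 : p < 1) (x : ℕ) :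
    0 ≤ negBinProb r p x := by
  have h : 0 ≤ Ring.choose ((x : ℝ) + r - 1) x := by
    have h2 := Ring.factorial_nsmul_multichoose_eq_ascPochhammer r x
    rw [Ring.multichoose_eq, Polynomial.ascPochhammer_smeval_eq_eval, nsmul_eq_mul,
      add_comm r] at h2
    have h3 := ascPochhammer_pos x r hr
    rw [← h2] at h3
    exact (pos_of_mul_pos_right h3 (by positivity)).le
  unfold negBinProb
  have := Real.rpow_nonneg (sub_nonneg.2 h1.le) r
  positivity

lemma hasSum_negBinProb {r p : ℝ} (h0 : 0 ≤ p) (h1 : p < 1) :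
    HasSum (negBinProb r p) 1 := by
  have h := (Real.one_div_one_sub_rpow_hasFPowerSeriesOnBall_zero r).hasSum (y := p)
    (by simpa [enorm_eq_nnnorm, abs_of_nonneg h0, ← NNReal.coe_lt_coe] using h1)
  have hp : 0 < (1 - p) ^ r := Real.rpow_pos_of_pos (by linarith) r
  have h2 := h.mul_right ((1 - p) ^ r)
  rw [zero_add, one_div_mul_cancel hp.ne'] at h2
  have h3 : negBinProb r p = fun i => ((FormalMultilinearSeries.ofScalars ℝ
      (fun n => Ring.choose (r + (n : ℝ) - 1) n) i) fun _ => p) * (1 - p) ^ r := by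
    ext x
    simp [negBinProb, FormalMultilinearSeries.ofScalars, add_comm r]
  rw [h3]
  exact h2

instance (r p : ℝ) : IsProbabilityMeasure (negBin r p) := by
  unfold negBin
  split_ifs with h
  · exact (hasSum_negBinProb h.2.1 h.2.2).isProbabilityMeasure_sum_dirac
      (negBinProb_nonneg h.1 h.2.1 h.2.2)
  · infer_instance

/-- The model `Θ ∼ SBSP(β, σ, c)`, `Z_d ∣ Θ ∼ NBP(Θ, r)` i.i.d. over the days `d`, realized on the
probability space `(Ω, P)`: `T` is the tilted largest jump `Δ_{0,h}`, `θ n` and `w n` are the rate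
and the label of unit `n`, so that `Θ = ∑ n, θ n • δ_{w n}`, and `A d n` is the number of triggers
of unit `n` on day `d + 1`. The kernel `G` is `t ↦ G_t`. -/
structure IsModel {Ω E : Type*} [MeasurableSpace Ω] [MeasurableSpace E]
    (σ β c r : ℝ) (G : Kernel ℝ (ℕ → ℝ)) (P₀ : Measure E) [IsProbabilityMeasure P₀]
    (P : Measure Ω) [IsProbabilityMeasure P]
    (T : Ω → ℝ) (θ : ℕ → Ω → ℝ) (w : ℕ → Ω → E) (A : ℕ → ℕ → Ω → ℕ) : Prop where
  measurable_jump : Measurable T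
  measurable_rate : ∀ n, Measurable (θ n)
  measurable_label : ∀ n, Measurable (w n)
  measurable_count : ∀ d n, Measurable (A d n)
  /-- `Δ_{0,h}` has its tilted density and, given `Δ_{0,h} = t`, the rates have law `G_t`. -/
  law_rates : P.map (fun ω => (T ω, fun n => θ n ω)) = tiltedJumpLaw σ β c ⊗ₘ G
  /-- The labels are i.i.d. with law `P₀`. -/
  law_labels : P.map (fun ω n => w n ω) = Measure.infinitePi (fun _ : ℕ => P₀)
  /-- The labels are independent of the rates. -/
  indep_labels : IndepFun (fun ω => (T ω, fun n => θ n ω)) (fun ω n => w n ω) P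
  /-- Given the jump, the rates and the labels, the counts `A d n` are independent over all `d`
  and `n`, and `A d n` is negative binomial with parameters `r` and `θ n`. -/
  law_counts :
    ∀ᵐ ω ∂P, condDistrib (fun ω (i : ℕ × ℕ) => A i.1 i.2 ω)
        (fun ω => (T ω, (fun n => θ n ω), (fun n => w n ω))) P
        (T ω, (fun n => θ n ω), (fun n => w n ω))
      = Measure.infinitePi (fun i : ℕ × ℕ => negBin r (θ i.2 ω))

/-- The observed data `Z_{1:D} = (Z_1, …, Z_D)`, with `Z_d = ∑ n, A_{d,n} δ_{w n}`. -/
def data {Ω E : Type*} [MeasurableSpace E] (w : ℕ → Ω → E) (A : ℕ → ℕ → Ω → ℕ) (D : ℕ) (ω : Ω) :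
    Fin D → Measure E :=
  fun d => Measure.sum (fun n => (A d n ω : ℝ≥0∞) • Measure.dirac (w n ω))

/-- The labels of the units which appear in the data `z`. -/
def users {E : Type*} [MeasurableSpace E] {D : ℕ} (z : Fin D → Measure E) : Set E :=
  {x | ∃ d, z d {x} ≠ 0}

/-- The number `N_D` of distinct units which appear in the data `z`. -/
def numUsers {E : Type*} [MeasurableSpace E] {D : ℕ} (z : Fin D → Measure E) : ℕ :=
  (users z).ncard

/-- `ψ_x^{(y)} = σ [B(r x + 1, -σ) - B(r (x + y) + 1, -σ)]`, where the beta function is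
`B(a, b) = Γ(a) Γ(b) / Γ(a + b)`, also for the negative argument `b = -σ`. -/
def psi (σ r x y : ℝ) : ℝ :=
  σ * (ProbabilityTheory.beta (r * x + 1) (-σ) - ProbabilityTheory.beta (r * (x + y) + 1) (-σ))

end SBSP

end

/-!
The variable `V = T ^ (-σ)` has, before any observation, the law `Gamma(c + 1, β)`
(`tiltedJumpLaw_eq`). Given the largest jump `t`, the ratios `Δ (n + 1) / Δ 0` are the points of a
Poisson process on `(0, 1)` with intensity `t ^ (-σ) ν`, where `ν` is the stable Lévy measure, so the
observed units form a thinned and marked Poisson process whose total intensity is `V ψ`. Since the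
marks (the label and the daily counts) have a law which does not depend on `V`, the likelihood of
the data is proportional to `V ^ N * exp (-V ψ)`, where `N` is the number of observed units, and the
gamma prior is conjugate to it.

There is no dominating measure for the data at hand, and densities are replaced by generating
functions. A Laplace functional of the data is a product over the units of weights depending on the
label and the counts. Inserting a further factor `y` for each observed unit and the factor
`exp (-l V)`, one gets
`E [exp (-l V) y ^ N W(Z)] = (β / (β + l + ψ - y ρ)) ^ (c + 1)`,
where `ρ` depends only on `W`; this is `IsModel.lintegral_unitWeight`. Comparing the values
of `(y, l)` given by `(1, l)` and `(y, 0)` for `y = (β + ψ) / (β + ψ + l)` yields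
`E [exp (-l V) W(Z)] = E [y ^ (N + c + 1) W(Z)]` (`IsModel.lintegral_expNeg_mul_data`), and
`y ^ (N + c + 1)` is the Laplace transform at `l` of `Gamma(N + c + 1, β + ψ)`. Laplace transforms
determine measures (`ext_of_lintegral_expNeg`), so the joint law of `(Z, V)` is identified.

Two ingredients need an argument of their own. The conditional law of the ratios is obtained in
`IsStableJumps.lintegral_ratio` by approximating the largest jump from below by a variable with
countably many values: restricted to the jumps below a fixed level, the process is independent of
the position of the jumps above it. And the number of users is not visibly a measurable function of
the data; `userCount` is a measurable version of it.
-/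

noncomputable section

namespace SBSP

open Filter Topology

/-! ### The Laplace functional of a Poisson point process -/

/-- The map `x ↦ exp (-x)` on `[0, ∞]`, with `exp (-∞) = 0`. -/
def expNeg (x : ℝ≥0∞) : ℝ≥0∞ := EReal.exp (-(x : EReal))

@[simp] lemma expNeg_zero : expNeg 0 = 1 := by simp [expNeg]

lemma expNeg_add (x y : ℝ≥0∞) : expNeg (x + y) = expNeg x * expNeg y := by
  unfold expNeg
  rw [← EReal.exp_add, EReal.coe_ennreal_add, EReal.neg_add, sub_eq_add_neg]
  · left; simp
  · right; simp

lemma expNeg_ofReal {x : ℝ} (hx : 0 ≤ x) :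
    expNeg (ENNReal.ofReal x) = ENNReal.ofReal (Real.exp (-x)) := by
  rw [expNeg, EReal.coe_ennreal_ofReal, max_eq_left hx, ← EReal.coe_neg, EReal.exp_coe]

lemma expNeg_strictAnti : StrictAnti expNeg := by
  intro x y h
  simpa [expNeg] using h

lemma expNeg_le_one (x : ℝ≥0∞) : expNeg x ≤ 1 := by
  simp [expNeg, EReal.coe_ennreal_nonneg]

lemma continuous_expNeg : Continuous expNeg :=
  ENNReal.continuous_exp.comp (continuous_neg.comp continuous_coe_ennreal_ereal)

@[fun_prop] lemma measurable_expNeg : Measurable expNeg := continuous_expNeg.measurable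

lemma expNeg_nat_mul (n : ℕ) (x : ℝ≥0∞) : expNeg (n * x) = expNeg x ^ n := by
  induction n with
  | zero => simp
  | succ n ih => rw [Nat.cast_succ, add_mul, one_mul, expNeg_add, ih, pow_succ]

lemma expNeg_sum {ι : Type*} (s : Finset ι) (f : ι → ℝ≥0∞) :
    expNeg (∑ i ∈ s, f i) = ∏ i ∈ s, expNeg (f i) := by
  classical
  induction s using Finset.induction_on with
  | empty => simp
  | insert a s h ih => rw [Finset.sum_insert h, Finset.prod_insert h, expNeg_add, ih]

lemma expNeg_tsum (f : ℕ → ℝ≥0∞) :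
    expNeg (∑' n, f n) = ⨅ K, ∏ n ∈ Finset.range K, expNeg (f n) := by
  have h1 := (continuous_expNeg.tendsto _).comp (ENNReal.tendsto_nat_tsum f)
  have h2 : Antitone fun K => ∏ n ∈ Finset.range K, expNeg (f n) := by
    refine antitone_nat_of_succ_le fun K => ?_
    rw [Finset.prod_range_succ]
    exact mul_le_of_le_one_right' (expNeg_le_one _)
  refine tendsto_nhds_unique h1 ?_
  simpa [Function.comp_def, expNeg_sum] using tendsto_atTop_iInf h2

/-- The inverse of `expNeg` on `[0, 1]`. -/
def negLog (x : ℝ≥0∞) : ℝ≥0∞ := (-(ENNReal.log x)).toENNReal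

@[fun_prop] lemma measurable_negLog : Measurable negLog :=
  (ENNReal.measurable_log.neg).ereal_toENNReal

lemma expNeg_negLog {x : ℝ≥0∞} (hx : x ≤ 1) : expNeg (negLog x) = x := by
  unfold expNeg negLog
  rw [EReal.coe_toENNReal, neg_neg, ENNReal.exp_log]
  rw [EReal.le_neg]
  simpa using hx

/-- The Laplace transform of a Poisson variable of mean `l`. -/
lemma lintegral_expNeg_poissonMeasure (c : ℝ≥0∞) (l : NNReal) :
    ∫⁻ n, expNeg (c * (n : ℝ≥0∞)) ∂(poissonMeasure l) = expNeg ((1 - expNeg c) * l) := by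
  set q := (expNeg c).toReal with hq
  have hq' : expNeg c = ENNReal.ofReal q :=
    (ENNReal.ofReal_toReal ((expNeg_le_one c).trans_lt ENNReal.one_lt_top).ne).symm
  have hq0 : 0 ≤ q := ENNReal.toReal_nonneg
  have hq1 : q ≤ 1 := by
    have := expNeg_le_one c
    rwa [hq', ENNReal.ofReal_le_one] at this
  have h1 : ∀ n : ℕ, expNeg (c * (n : ℝ≥0∞)) * poissonMeasure l {n} =
      ENNReal.ofReal (Real.exp (-l) * ((q * l) ^ n / n.factorial)) := by
    intro n
    rw [mul_comm c, expNeg_nat_mul, poissonMeasure_singleton, hq', ← ENNReal.ofReal_pow hq0,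
      ← ENNReal.ofReal_mul (by positivity)]
    congr 1
    ring
  have h2 : HasSum (fun n : ℕ => Real.exp (-l) * ((q * l) ^ n / n.factorial))
      (Real.exp (-l) * Real.exp (q * l)) := by
    rw [Real.exp_eq_exp_ℝ]
    exact (NormedSpace.expSeries_div_hasSum_exp (q * (l : ℝ))).mul_left _
  rw [lintegral_countable']
  simp_rw [h1]
  rw [← ENNReal.ofReal_tsum_of_nonneg (fun n => by positivity) h2.summable, h2.tsum_eq,
    ← Real.exp_add, hq', ← ENNReal.ofReal_one, ← ENNReal.ofReal_sub _ hq0,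
    ← ENNReal.ofReal_coe_nnreal, ← ENNReal.ofReal_mul (by linarith), expNeg_ofReal
    (x := (1 - q) * l) (mul_nonneg (by linarith) l.2)]
  congr 2
  ring

section Laplace

variable {Ω E : Type*} [MeasurableSpace Ω] [MeasurableSpace E]
  {P : Measure Ω} {ν : Measure E} {N : Ω → Measure E}

lemma IsPoissonProcess.measurable_count (h : IsPoissonProcess P ν N) {B : Set E}
    (hB : MeasurableSet B) : Measurable fun ω => N ω B :=
  (Measure.measurable_coe hB).comp h.measurable

variable [IsProbabilityMeasure P]

/-- The Laplace transform of a single count; the case `ν B = ∞` is included. -/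
lemma IsPoissonProcess.lintegral_expNeg_count (h : IsPoissonProcess P ν N) {B : Set E}
    (hB : MeasurableSet B) (c : ℝ≥0∞) :
    ∫⁻ ω, expNeg (c * N ω B) ∂P = expNeg ((1 - expNeg c) * ν B) := by
  by_cases hν : ν B = ∞
  · have h1 : ∀ᵐ ω ∂P, expNeg (c * N ω B) = expNeg ((1 - expNeg c) * ν B) := by
      filter_upwards [h.count_top B hB hν] with ω hω
      rw [hω, hν]
      rcases eq_or_ne c 0 with rfl | hc
      · simp
      · have : expNeg c < 1 := by
          rw [← expNeg_zero]; exact expNeg_strictAnti (pos_iff_ne_zero.2 hc)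
        rw [ENNReal.mul_top hc, ENNReal.mul_top (tsub_pos_of_lt this).ne']
    rw [lintegral_congr_ae h1]
    simp
  · have h1 := h.law_count B hB hν
    have h2 : ∫⁻ ω, expNeg (c * N ω B) ∂P =
        ∫⁻ x, expNeg (c * x) ∂(P.map fun ω => N ω B) := by
      rw [lintegral_map (by fun_prop) (h.measurable_count hB)]
    rw [h2, h1, lintegral_map (by fun_prop) (by fun_prop), lintegral_expNeg_poissonMeasure,
      ENNReal.coe_toNNReal hν]

lemma IsPoissonProcess.lintegral_expNeg_simpleFunc (h : IsPoissonProcess P ν N)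
    (f : SimpleFunc E ℝ≥0∞) :
    ∫⁻ ω, expNeg (∫⁻ x, f x ∂(N ω)) ∂P = expNeg (∫⁻ x, (1 - expNeg (f x)) ∂ν) := by
  set e := f.range.equivFin
  set B : Fin f.range.card → Set E := fun i => f ⁻¹' {(e.symm i : ℝ≥0∞)} with hBdef
  have hB : ∀ i, MeasurableSet (B i) := fun i => f.measurableSet_fiber _
  have hdisj : Pairwise (fun i j => Disjoint (B i) (B j)) := by
    intro i j hij
    refine Set.disjoint_left.2 fun x hx hy => hij ?_
    have : (e.symm i : ℝ≥0∞) = e.symm j := by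
      rw [← (hx : f x = _), ← (hy : f x = _)]
    exact e.symm.injective (Subtype.ext this)
  have hI := h.indep _ B hB hdisj
  have h1 : ∀ ω, expNeg (∫⁻ x, f x ∂(N ω)) =
      ∏ i, expNeg ((e.symm i : ℝ≥0∞) * N ω (B i)) := by
    intro ω
    have h2 := f.lintegral_eq_lintegral (N ω)
    rw [SimpleFunc.lintegral, ← Finset.sum_coe_sort, ← e.symm.sum_comp] at h2
    rw [h2, expNeg_sum]
  simp_rw [h1]
  rw [lintegral_prod_eq_prod_lintegral_of_indepFun Finset.univ
    (fun i ω => expNeg ((e.symm i : ℝ≥0∞) * N ω (B i)))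
    (hI.comp (fun i x => expNeg ((e.symm i : ℝ≥0∞) * x)) (fun i => by fun_prop))
    (fun i => by have := h.measurable_count (hB i); fun_prop)]
  simp_rw [h.lintegral_expNeg_count (hB _)]
  rw [← expNeg_sum]
  congr 1
  have h2 := (f.map fun c => 1 - expNeg c).lintegral_eq_lintegral ν
  rw [SimpleFunc.map_lintegral] at h2
  rw [← Finset.sum_coe_sort, ← e.symm.sum_comp] at h2
  simpa using h2.symm

/-- Laplace functional of a Poisson point process. -/
theorem IsPoissonProcess.lintegral_expNeg (h : IsPoissonProcess P ν N) {f : E → ℝ≥0∞}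
    (hf : Measurable f) :
    ∫⁻ ω, expNeg (∫⁻ x, f x ∂(N ω)) ∂P = expNeg (∫⁻ x, (1 - expNeg (f x)) ∂ν) := by
  have hmono : Monotone fun m x => SimpleFunc.eapprox f m x :=
    fun i j hij x => SimpleFunc.monotone_eapprox f hij x
  have hlim : ∀ x, Tendsto (fun m => SimpleFunc.eapprox f m x) atTop (𝓝 (f x)) := fun x => by
    rw [← SimpleFunc.iSup_eapprox_apply hf x]
    exact tendsto_atTop_iSup fun i j hij => hmono hij x
  have hL : Tendsto (fun m => ∫⁻ ω, expNeg (∫⁻ x, SimpleFunc.eapprox f m x ∂(N ω)) ∂P) atTop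
      (𝓝 (∫⁻ ω, expNeg (∫⁻ x, f x ∂(N ω)) ∂P)) := by
    refine tendsto_lintegral_of_dominated_convergence (fun _ => 1) (fun m => ?_)
      (fun m => ae_of_all _ fun ω => expNeg_le_one _) (by simp) (ae_of_all _ fun ω => ?_)
    · exact measurable_expNeg.comp
        ((Measure.measurable_lintegral (SimpleFunc.measurable _)).comp h.measurable)
    · refine (continuous_expNeg.tendsto _).comp ?_
      exact lintegral_tendsto_of_tendsto_of_monotone (fun m => (SimpleFunc.measurable _).aemeasurable)
        (ae_of_all _ fun x i j hij => hmono hij x) (ae_of_all _ hlim)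
  have hR : Tendsto (fun m => expNeg (∫⁻ x, (1 - expNeg (SimpleFunc.eapprox f m x)) ∂ν)) atTop
      (𝓝 (expNeg (∫⁻ x, (1 - expNeg (f x)) ∂ν))) := by
    refine (continuous_expNeg.tendsto _).comp ?_
    refine lintegral_tendsto_of_tendsto_of_monotone (fun m => by fun_prop)
      (ae_of_all _ fun x i j hij => ?_) (ae_of_all _ fun x => ?_)
    · exact tsub_le_tsub_left (expNeg_strictAnti.antitone (hmono hij x)) _
    · exact ENNReal.Tendsto.sub tendsto_const_nhds ((continuous_expNeg.tendsto _).comp (hlim x))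
        (Or.inl (by simp))
  refine tendsto_nhds_unique hL ?_
  simp_rw [h.lintegral_expNeg_simpleFunc]
  exact hR

/-- The Laplace functional of a Poisson point process `∑ n, δ_{Δ n}`, written as a product over
its points. -/
theorem IsPoissonProcess.lintegral_iInf_prod {Δ : ℕ → Ω → E}
    (h : IsPoissonProcess P ν fun ω => Measure.sum fun n => Measure.dirac (Δ n ω))
    {φ : E → ℝ≥0∞} (hφ : Measurable φ) (hφ1 : ∀ x, φ x ≤ 1) :
    ∫⁻ ω, ⨅ K, ∏ n ∈ Finset.range K, φ (Δ n ω) ∂P = expNeg (∫⁻ x, (1 - φ x) ∂ν) := by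
  have hf : Measurable fun x => negLog (φ x) := by fun_prop
  have h1 := h.lintegral_expNeg hf
  simp_rw [expNeg_negLog (hφ1 _)] at h1
  rw [← h1]
  refine lintegral_congr fun ω => ?_
  rw [lintegral_sum_measure]
  simp_rw [lintegral_dirac' _ hf]
  rw [expNeg_tsum]
  simp_rw [expNeg_negLog (hφ1 _)]

end Laplace

/-! ### The stable Lévy measure -/

lemma lintegral_stableLevy (σ : ℝ) {f : ℝ → ℝ≥0∞} (hf : Measurable f) :
    ∫⁻ s, f s ∂(stableLevy σ) = ∫⁻ s in Ioi 0, ENNReal.ofReal (σ * s ^ (-1 - σ)) * f s := by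
  rw [stableLevy, lintegral_withDensity_eq_lintegral_mul _ (by fun_prop) hf]
  rfl

lemma stableLevy_Iic_zero (σ : ℝ) : stableLevy σ (Iic 0) = 0 := by
  rw [stableLevy, withDensity_apply _ measurableSet_Iic, Measure.restrict_restrict measurableSet_Iic,
    Iic_inter_Ioi, Ioc_self, Measure.restrict_empty, lintegral_zero_measure]

lemma ae_stableLevy_pos (σ : ℝ) : ∀ᵐ s ∂(stableLevy σ), 0 < s := by
  rw [ae_iff]
  simpa [← Iic_def] using stableLevy_Iic_zero σ

lemma stableLevy_Ioi {σ b : ℝ} (hσ : 0 < σ) (hb : 0 < b) :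
    stableLevy σ (Ioi b) = ENNReal.ofReal (b ^ (-σ)) := by
  rw [stableLevy, withDensity_apply _ measurableSet_Ioi, Measure.restrict_restrict measurableSet_Ioi,
    inter_eq_left.2 (Ioi_subset_Ioi hb.le), ← ofReal_integral_eq_lintegral_ofReal]
  · rw [integral_const_mul, integral_Ioi_rpow_of_lt (by linarith) hb]
    congr 1
    rw [show -1 - σ + 1 = -σ by ring]
    field_simp
  · exact (integrableOn_Ioi_rpow_of_lt (by linarith) hb).const_mul _
  · filter_upwards [ae_restrict_mem measurableSet_Ioi] with s hs
    have : 0 < s := hb.trans hs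
    simp only [Pi.zero_apply]
    positivity

/-- Scaling property of the stable Lévy measure. -/
lemma lintegral_stableLevy_div (σ : ℝ) {τ : ℝ} (hτ : 0 < τ) {g : ℝ → ℝ≥0∞} (hg : Measurable g) :
    ∫⁻ s, g (s / τ) ∂(stableLevy σ) = ENNReal.ofReal (τ ^ (-σ)) * ∫⁻ s, g s ∂(stableLevy σ) := by
  rw [lintegral_stableLevy σ (by fun_prop), lintegral_stableLevy σ hg,
    ← lintegral_indicator measurableSet_Ioi, ← lintegral_indicator measurableSet_Ioi]
  have hm : Measurable ((Ioi (0 : ℝ)).indicator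
      fun s => ENNReal.ofReal (σ * s ^ (-1 - σ)) * g (s / τ)) :=
    Measurable.indicator (by fun_prop) measurableSet_Ioi
  have hm' : Measurable fun x => (Ioi (0 : ℝ)).indicator
      (fun s => ENNReal.ofReal (σ * s ^ (-1 - σ)) * g (s / τ)) (τ * x) := hm.comp (by fun_prop)
  rw [← Real.smul_map_volume_mul_left hτ.ne', lintegral_smul_measure,
    lintegral_map hm (by fun_prop), Real.smul_map_volume_mul_left hτ.ne', smul_eq_mul,
    ← lintegral_const_mul _ hm', ← lintegral_const_mul]
  · refine lintegral_congr fun x => ?_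
    by_cases hx : 0 < x
    · rw [indicator_of_mem (mem_Ioi.2 (mul_pos hτ hx)), indicator_of_mem (mem_Ioi.2 hx),
        mul_div_cancel_left₀ _ hτ.ne', ← mul_assoc, ← mul_assoc,
        ← ENNReal.ofReal_mul (abs_nonneg _), ← ENNReal.ofReal_mul (by positivity)]
      congr 2
      rw [abs_of_pos hτ, Real.mul_rpow hτ.le hx.le, show -1 - σ = -σ - 1 by ring,
        Real.rpow_sub_one hτ.ne']
      field_simp
    · rw [indicator_of_notMem, indicator_of_notMem, mul_zero, mul_zero]
      · exact hx
      · exact fun h => hx (pos_of_mul_pos_right h hτ.le)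
  · exact Measurable.indicator (by fun_prop) measurableSet_Ioi

/-! ### Infinite products -/

lemma antitone_prod_range {a : ℕ → ℝ≥0∞} (ha : ∀ n, a n ≤ 1) :
    Antitone fun K => ∏ n ∈ Finset.range K, a n := by
  refine antitone_nat_of_succ_le fun K => ?_
  rw [Finset.prod_range_succ]
  exact mul_le_of_le_one_right' (ha K)

lemma iInf_prod_range_le_one (a : ℕ → ℝ≥0∞) : ⨅ K, ∏ n ∈ Finset.range K, a n ≤ 1 :=
  (iInf_le _ 0).trans (by simp)

lemma iInf_prod_range_eq_of_tail {a : ℕ → ℝ≥0∞} (ha : ∀ n, a n ≤ 1) {K : ℕ}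
    (hK : ∀ n, K ≤ n → a n = 1) :
    ⨅ K, ∏ n ∈ Finset.range K, a n = ∏ n ∈ Finset.range K, a n := by
  refine le_antisymm (iInf_le _ K) (le_iInf fun J => ?_)
  rcases le_total J K with h | h
  · exact antitone_prod_range ha h
  · rw [← Finset.prod_range_mul_prod_Ico _ h, Finset.prod_eq_one (s := Finset.Ico K J), mul_one]
    exact fun n hn => hK n (Finset.mem_Ico.1 hn).1

/-- Decomposition of an integral along the fibers of a random index. -/
lemma lintegral_comp_nat_fiber {Ω : Type*} [MeasurableSpace Ω] {Q : Measure Ω} {κ : Ω → ℕ}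
    (hκ : Measurable κ) (F : ℕ → Ω → ℝ≥0∞) :
    ∫⁻ ω, F (κ ω) ω ∂Q = ∑' k, ∫⁻ ω in κ ⁻¹' {k}, F k ω ∂Q := by
  have h1 : (⋃ k, κ ⁻¹' {k}) = univ := by ext; simp
  rw [← setLIntegral_univ, ← h1, lintegral_iUnion (fun k => hκ (measurableSet_singleton k))]
  · refine tsum_congr fun k => setLIntegral_congr_fun (hκ (measurableSet_singleton k)) ?_
    intro ω hω
    simp only [mem_preimage, mem_singleton_iff] at hω
    simp only [hω]
  · intro i j hij
    exact Disjoint.preimage _ (by simpa using hij)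

/-! ### The jumps given the largest one -/

section Jumps

variable {Ω : Type*} [MeasurableSpace Ω] {σ : ℝ} {Q : Measure Ω}
  {Δ : ℕ → Ω → ℝ}

variable [IsProbabilityMeasure Q] in
/-- The Laplace functional of the indicator of `(0, ∞)` shows that no jump is in `(-∞, 0]`. -/
lemma IsStableJumps.ae_pos (h : IsStableJumps σ Q Δ) : ∀ᵐ ω ∂Q, ∀ n, 0 < Δ n ω := by
  have h1 := h.poisson.lintegral_iInf_prod (φ := (Ioi (0 : ℝ)).indicator 1)
    (measurable_one.indicator measurableSet_Ioi) (fun x => indicator_le_self' (by simp) x)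
  have h2 : ∫⁻ x, (1 - (Ioi (0 : ℝ)).indicator 1 x) ∂(stableLevy σ) = 0 := by
    rw [← lintegral_zero (μ := stableLevy σ)]
    refine lintegral_congr_ae ?_
    filter_upwards [ae_stableLevy_pos σ] with s hs
    simp [hs]
  rw [h2, expNeg_zero] at h1
  have hm : Measurable fun ω => ⨅ K, ∏ n ∈ Finset.range K, (Ioi (0 : ℝ)).indicator
      (1 : ℝ → ℝ≥0∞) (Δ n ω) :=
    Measurable.iInf fun K => Finset.measurable_prod _ fun n _ =>
      (measurable_one.indicator measurableSet_Ioi).comp (h.measurable n)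
  have h3 : ∀ᵐ ω ∂Q, (⨅ K, ∏ n ∈ Finset.range K, (Ioi (0 : ℝ)).indicator
      (1 : ℝ → ℝ≥0∞) (Δ n ω)) = 1 := by
    refine ae_eq_of_ae_le_of_lintegral_le (ae_of_all _ fun ω => iInf_prod_range_le_one _) ?_
      (by fun_prop) (by simp [h1])
    simp [h1]
  filter_upwards [h3] with ω hω n
  by_contra hn
  have h4 : (⨅ K, ∏ n ∈ Finset.range K, (Ioi (0 : ℝ)).indicator
      (1 : ℝ → ℝ≥0∞) (Δ n ω)) ≤ 0 := by
    refine (iInf_le _ (n + 1)).trans ?_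
    rw [Finset.prod_range_succ, indicator_of_notMem (by simpa using hn), mul_zero]
  simp [hω] at h4

lemma IsStableJumps.ae_eventually_le (h : IsStableJumps σ Q Δ) (hσ : 0 < σ) {ε : ℝ} (hε : 0 < ε) :
    ∀ᵐ ω ∂Q, ∀ᶠ n in atTop, Δ n ω ≤ ε := by
  have h1 := h.poisson.law_count (Ioi ε) measurableSet_Ioi
    (by rw [stableLevy_Ioi hσ hε]; exact ENNReal.ofReal_ne_top)
  have h2 : ∀ᵐ x ∂(Q.map fun ω => (Measure.sum fun n => Measure.dirac (Δ n ω)) (Ioi ε)),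
      x ≠ ∞ := by
    rw [h1]
    exact (ae_map_iff (by fun_prop) (measurableSet_singleton ∞).compl).2
      (ae_of_all _ fun n => ENNReal.natCast_ne_top n)
  have h3 := ae_of_ae_map (h.poisson.measurable_count measurableSet_Ioi).aemeasurable h2
  filter_upwards [h3] with ω hω
  rw [Measure.sum_apply _ measurableSet_Ioi] at hω
  have h4 := ENNReal.tendsto_atTop_zero_of_tsum_ne_top hω
  filter_upwards [h4.eventually (gt_mem_nhds zero_lt_one)] with n hn
  by_contra hc
  rw [Measure.dirac_apply_of_mem (by simpa using hc)] at hn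
  exact lt_irrefl _ hn

lemma IsStableJumps.ae_tendsto_zero (h : IsStableJumps σ Q Δ) (hσ : 0 < σ) :
    ∀ᵐ ω ∂Q, ∀ ε > 0, ∀ᶠ n in atTop, Δ n ω < ε := by
  have h1 : ∀ᵐ ω ∂Q, ∀ k : ℕ, ∀ᶠ n in atTop, Δ n ω ≤ 1 / ((k : ℝ) + 1) :=
    ae_all_iff.2 fun k => h.ae_eventually_le hσ (by positivity)
  filter_upwards [h1] with ω hω ε hε
  obtain ⟨k, hk⟩ := exists_nat_one_div_lt hε
  filter_upwards [hω k] with n hn using hn.trans_lt hk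

variable [IsProbabilityMeasure Q]

/-- The product of `φ (Δ n / τ)` over the jumps smaller than `τ`. -/
def prodBelow (Δ : ℕ → Ω → ℝ) (φ : ℝ → ℝ≥0∞) (τ : ℝ) (ω : Ω) : ℝ≥0∞ :=
  ⨅ K, ∏ n ∈ Finset.range K, if Δ n ω < τ then φ (Δ n ω / τ) else 1

/-- Restricted to the jumps below a level `τ`, the jump process is independent of the event that
the largest jump lies in `C' \ C`, which only concerns the jumps above `τ`. -/
lemma IsStableJumps.setLIntegral_prodBelow (h : IsStableJumps σ Q Δ)
    {φ : ℝ → ℝ≥0∞} (hφ : Measurable φ) (hφ1 : ∀ x, φ x ≤ 1) {τ : ℝ} (hτ : 0 < τ)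
    {C C' : Set ℝ} (hC : MeasurableSet C) (hC' : MeasurableSet C') (hup : IsUpperSet C)
    (hup' : IsUpperSet C') (hCC' : C ⊆ C') (hCτ : C' ⊆ Ici τ) :
    ∫⁻ ω in Δ 0 ⁻¹' (C' \ C), prodBelow Δ φ τ ω ∂Q =
      Q (Δ 0 ⁻¹' (C' \ C)) * expNeg (ENNReal.ofReal (τ ^ (-σ)) *
        ∫⁻ s in Iio 1, (1 - φ s) ∂(stableLevy σ)) := by
  -- as `C` is an upper set, `Δ 0 ∉ C` says that no jump is in `C`, which is encoded in the Laplace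
  -- functional by a test function that vanishes on `C`
  have key : ∀ C : Set ℝ, MeasurableSet C → IsUpperSet C → C ⊆ Ici τ →
      ∀ φ : ℝ → ℝ≥0∞, Measurable φ → (∀ x, φ x ≤ 1) →
      ∫⁻ ω in Δ 0 ⁻¹' Cᶜ, prodBelow Δ φ τ ω ∂Q = expNeg (stableLevy σ C) *
        expNeg (ENNReal.ofReal (τ ^ (-σ)) * ∫⁻ s in Iio 1, (1 - φ s) ∂(stableLevy σ)) := by
    classical
    intro C hC hup hCτ φ hφ hφ1
    have hψ : Measurable fun s => if s < τ then φ (s / τ) else 1 :=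
      Measurable.ite measurableSet_Iio (by fun_prop) measurable_const
    have h1 := h.poisson.lintegral_iInf_prod
      (φ := fun s => if s ∈ C then 0 else if s < τ then φ (s / τ) else 1)
      (Measurable.ite hC measurable_const hψ)
      (fun x => by
        split_ifs
        · simp
        · exact hφ1 _
        · exact le_rfl)
    have h2 : ∫⁻ s, (1 - if s ∈ C then 0 else if s < τ then φ (s / τ) else 1) ∂(stableLevy σ) =
        stableLevy σ C + ENNReal.ofReal (τ ^ (-σ)) *
          ∫⁻ s in Iio 1, (1 - φ s) ∂(stableLevy σ) := by
      rw [← lintegral_indicator measurableSet_Iio, ← lintegral_stableLevy_div σ hτ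
        (Measurable.indicator (by fun_prop) measurableSet_Iio), ← lintegral_indicator_one hC,
        ← lintegral_add_left (measurable_one.indicator hC)]
      refine lintegral_congr fun s => ?_
      by_cases hs : s ∈ C
      · have : ¬ (s / τ < 1) := by
          rw [not_lt, le_div_iff₀ hτ, one_mul]; exact hCτ hs
        simp [hs, this]
      · by_cases hs' : s < τ
        · have : s / τ < 1 := by rwa [div_lt_one hτ]
          simp [hs, hs', this]
        · have : ¬ s / τ < 1 := by rwa [div_lt_one hτ]
          simp [hs, hs', this]
    rw [h2, expNeg_add] at h1
    rw [← h1, ← lintegral_indicator (h.measurable 0 hC.compl)]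
    refine lintegral_congr_ae ?_
    filter_upwards [h.decreasing] with ω hω
    by_cases h0 : Δ 0 ω ∈ C
    · rw [indicator_of_notMem (by simpa using h0)]
      refine (le_antisymm ((iInf_le _ 1).trans ?_) zero_le).symm
      simp [h0]
    · have : ∀ n, Δ n ω ∉ C := fun n hn => h0 (hup (hω.antitone (Nat.zero_le n)) hn)
      rw [indicator_of_mem (by simpa using h0)]
      simp [prodBelow, this]
  have hsplit : ∀ F : Ω → ℝ≥0∞, ∫⁻ ω in Δ 0 ⁻¹' (C' \ C), F ω ∂Q + ∫⁻ ω in Δ 0 ⁻¹' C'ᶜ, F ω ∂Q =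
      ∫⁻ ω in Δ 0 ⁻¹' Cᶜ, F ω ∂Q := by
    intro F
    rw [← lintegral_union (h.measurable 0 hC'.compl)]
    · congr 2
      ext ω
      simp only [mem_union, mem_preimage, Set.mem_sdiff, mem_compl_iff]
      constructor
      · rintro (⟨-, h⟩ | h)
        · exact h
        · exact fun h' => h (hCC' h')
      · intro h
        by_cases h' : Δ 0 ω ∈ C'
        · exact Or.inl ⟨h', h⟩
        · exact Or.inr h'
    · exact Disjoint.preimage _ (Set.disjoint_left.2 fun x hx hx' => hx' hx.1)
  have hone : ∀ ω, prodBelow Δ 1 τ ω = 1 := by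
    intro ω
    simp [prodBelow]
  have e1 := hsplit (prodBelow Δ φ τ)
  have e2 := hsplit (prodBelow Δ 1 τ)
  rw [key C hC hup (hCC'.trans hCτ) φ hφ hφ1, key C' hC' hup' hCτ φ hφ hφ1] at e1
  rw [key C hC hup (hCC'.trans hCτ) 1 measurable_one (by simp),
    key C' hC' hup' hCτ 1 measurable_one (by simp)] at e2
  simp only [hone, setLIntegral_one, Pi.one_apply, tsub_self, lintegral_zero, mul_zero,
    expNeg_zero, mul_one] at e2
  rw [← e2, add_mul] at e1
  refine (ENNReal.add_left_inj ?_).1 e1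
  exact ENNReal.mul_ne_top ((expNeg_le_one _).trans_lt ENNReal.one_lt_top).ne
    ((expNeg_le_one _).trans_lt ENNReal.one_lt_top).ne

/-- A discretization of `s > 0` from below, on the grid of the points `(m + 1) / (k + 1)`. -/
def gridBelow (m : ℕ) (s : ℝ) : ℝ := ((m : ℝ) + 1) / (⌊((m : ℝ) + 1) / s⌋₊ + 1)

lemma gridBelow_pos (m : ℕ) (s : ℝ) : 0 < gridBelow m s := by
  unfold gridBelow
  positivity

lemma gridBelow_lt (m : ℕ) {s : ℝ} (hs : 0 < s) : gridBelow m s < s := by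
  unfold gridBelow
  have h := Nat.lt_floor_add_one (((m : ℝ) + 1) / s)
  rw [div_lt_iff₀ hs] at h
  rw [div_lt_iff₀ (by positivity)]
  linarith

lemma tendsto_gridBelow {s : ℝ} (hs : 0 < s) :
    Tendsto (fun m => gridBelow m s) atTop (𝓝 s) := by
  have h1 : Tendsto (fun m : ℕ => ((⌊((m : ℝ) + 1) / s⌋₊ : ℝ) + 1) / ((m : ℝ) + 1)) atTop
      (𝓝 s⁻¹) := by
    have h0 : Tendsto (fun m : ℕ => s⁻¹ + 1 / ((m : ℝ) + 1)) atTop (𝓝 (s⁻¹ + 0)) :=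
      tendsto_const_nhds.add tendsto_one_div_add_atTop_nhds_zero_nat
    rw [add_zero] at h0
    refine tendsto_of_tendsto_of_tendsto_of_le_of_le tendsto_const_nhds h0 (fun m => ?_)
      (fun m => ?_)
    · have h := (Nat.lt_floor_add_one (((m : ℝ) + 1) / s)).le
      show s⁻¹ ≤ _
      rw [le_div_iff₀ (by positivity)]
      convert h using 1
      field_simp
    · have h := Nat.floor_le (show 0 ≤ ((m : ℝ) + 1) / s by positivity)
      show _ ≤ s⁻¹ + 1 / ((m : ℝ) + 1)
      rw [div_le_iff₀ (by positivity), add_mul, one_div_mul_cancel (by positivity)]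
      have : ((m : ℝ) + 1) / s = s⁻¹ * (m + 1) := by field_simp
      linarith
  have h2 := h1.inv₀ (by positivity)
  simp only [inv_inv, inv_div] at h2
  exact h2

@[fun_prop] lemma measurable_gridBelow (m : ℕ) : Measurable (gridBelow m) := by
  unfold gridBelow
  fun_prop

/-- The conditional Laplace functional of the jumps below the discretized largest jump, obtained
by summing over the values of the discretization. -/
lemma IsStableJumps.lintegral_gridBelow (h : IsStableJumps σ Q Δ)
    {φ : ℝ → ℝ≥0∞} (hφ : Measurable φ) (hφ1 : ∀ x, φ x ≤ 1) (u : ℝ → ℝ≥0∞) (m : ℕ) :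
    ∫⁻ ω, u (gridBelow m (Δ 0 ω)) * prodBelow Δ φ (gridBelow m (Δ 0 ω)) ω ∂Q =
      ∫⁻ ω, u (gridBelow m (Δ 0 ω)) * expNeg (ENNReal.ofReal (gridBelow m (Δ 0 ω) ^ (-σ)) *
        ∫⁻ s in Iio 1, (1 - φ s) ∂(stableLevy σ)) ∂Q := by
  set I := ∫⁻ s in Iio 1, (1 - φ s) ∂(stableLevy σ)
  set M : ℝ := (m : ℝ) + 1 with hM
  have hM0 : 0 < M := by positivity
  set κ : Ω → ℕ := fun ω => ⌊M / Δ 0 ω⌋₊ with hκ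
  have h0 := h.measurable 0
  have hκm : Measurable κ := by fun_prop
  have e1 := lintegral_comp_nat_fiber (Q := Q) hκm
    fun k ω => u (M / (k + 1)) * prodBelow Δ φ (M / (k + 1)) ω
  have e2 := lintegral_comp_nat_fiber (Q := Q) hκm
    fun k ω => u (M / (k + 1)) * expNeg (ENNReal.ofReal ((M / (k + 1)) ^ (-σ)) * I)
  refine e1.trans (Eq.trans ?_ e2.symm)
  refine tsum_congr fun k => ?_
  -- the discretization takes the value `M / (k + 1)` when the largest jump is in `C (k + 1) \ C k`
  set C : ℕ → Set ℝ := fun k => {s | 0 < s ∧ M < s * k} with hCdef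
  have hCm : ∀ k, MeasurableSet (C k) := fun k =>
    (measurableSet_lt measurable_const measurable_id).inter
      (measurableSet_lt measurable_const (measurable_id.mul_const (k : ℝ)))
  have hCup : ∀ k, IsUpperSet (C k) := by
    intro k a b hab ha
    exact ⟨ha.1.trans_le hab, ha.2.trans_le (by gcongr)⟩
  have hset : (κ ⁻¹' {k} : Set Ω) =ᵐ[Q] Δ 0 ⁻¹' (C (k + 1) \ C k) := by
    filter_upwards [h.ae_pos] with ω hω
    refine propext ?_
    change κ ω = k ↔ Δ 0 ω ∈ C (k + 1) ∧ ¬ Δ 0 ω ∈ C k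
    have hp := hω 0
    rw [hκ, Nat.floor_eq_iff (by positivity), le_div_iff₀ hp, div_lt_iff₀ hp]
    simp only [hCdef, Set.mem_ofPred_eq, hp, true_and, not_lt]
    push_cast
    rw [mul_comm (Δ 0 ω), mul_comm (Δ 0 ω), and_comm]
  rw [setLIntegral_congr hset, setLIntegral_congr hset, lintegral_const_mul'',
    h.setLIntegral_prodBelow hφ hφ1 (by positivity) (hCm k) (hCm (k + 1)) (hCup k) (hCup (k + 1)),
    setLIntegral_const, mul_comm (Q _), mul_assoc]
  · rintro s ⟨h1, h2⟩
    refine ⟨h1, h2.trans_le ?_⟩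
    gcongr
    simp
  · rintro s ⟨h1, h2⟩
    rw [mem_Ici, div_le_iff₀ (by positivity)]
    push_cast at h2
    exact h2.le
  · refine Measurable.aemeasurable (Measurable.iInf fun K => Finset.measurable_prod _ fun n _ => ?_)
    exact Measurable.ite (h.measurable n measurableSet_Iio) (by have := h.measurable n; fun_prop)
      measurable_const

end Jumps

section Jumps

variable {Ω : Type*} [MeasurableSpace Ω] {σ : ℝ} {Q : Measure Ω} {Δ : ℕ → Ω → ℝ}

omit [MeasurableSpace Ω] in
/-- The discretization stays strictly below `Δ 0`, so that the largest jump never contributes to the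
product, and all other jumps do in the limit. -/
lemma tendsto_prodBelow {φ : ℝ → ℝ≥0∞} (hφ1 : ∀ x, φ x ≤ 1) {ε : ℝ} (hε : 0 < ε)
    (hφε : ∀ x < ε, φ x = 1) (hφc : ContinuousOn φ (Ioo 0 1)) {ω : Ω} (hpos : ∀ n, 0 < Δ n ω)
    (hanti : StrictAnti fun n => Δ n ω) (hzero : ∀ ε > 0, ∀ᶠ n in atTop, Δ n ω < ε) :
    Tendsto (fun m => prodBelow Δ φ (gridBelow m (Δ 0 ω)) ω) atTop
      (𝓝 (⨅ K, ∏ n ∈ Finset.range K, φ (Δ (n + 1) ω / Δ 0 ω))) := by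
  set s := Δ 0 ω with hs
  have hs0 : 0 < s := hpos 0
  obtain ⟨n₀, hn₀⟩ := eventually_atTop.1 (hzero (ε * (s / 2)) (by positivity))
  have hd := tendsto_gridBelow hs0
  rw [iInf_prod_range_eq_of_tail (fun n => hφ1 _) (K := n₀)]
  swap
  · intro n hn
    refine hφε _ ?_
    rw [div_lt_iff₀ hs0]
    refine (hn₀ (n + 1) (by omega)).trans ?_
    gcongr
    linarith
  have h1 : ∀ᶠ m in atTop, ∏ n ∈ Finset.range n₀, (if Δ (n + 1) ω < gridBelow m s then
      φ (Δ (n + 1) ω / gridBelow m s) else 1) = prodBelow Δ φ (gridBelow m s) ω := by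
    filter_upwards [hd.eventually (lt_mem_nhds (show s / 2 < s by linarith))] with m hm
    rw [prodBelow, iInf_prod_range_eq_of_tail (K := n₀ + 1), Finset.prod_range_succ',
      if_neg (not_lt.2 (gridBelow_lt m hs0).le), mul_one]
    · intro n
      split_ifs
      · exact hφ1 _
      · exact le_rfl
    · intro n hn
      split_ifs
      · refine hφε _ ?_
        rw [div_lt_iff₀ (gridBelow_pos _ _)]
        refine (hn₀ n (by omega)).trans ?_
        gcongr
      · rfl
  refine Tendsto.congr' h1 (ENNReal.tendsto_finsetProd_of_ne_top _ (fun n _ => ?_)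
    fun n _ => ((hφ1 _).trans_lt ENNReal.one_lt_top).ne)
  have h2 : Δ (n + 1) ω < s := hanti (Nat.succ_pos n)
  have h3 : Tendsto (fun m => φ (Δ (n + 1) ω / gridBelow m s)) atTop
      (𝓝 (φ (Δ (n + 1) ω / s))) := by
    refine (hφc.continuousAt (Ioo_mem_nhds (div_pos (hpos _) hs0) ?_)).tendsto.comp ?_
    · rwa [div_lt_one hs0]
    · exact tendsto_const_nhds.div hd hs0.ne'
  refine h3.congr' ?_
  filter_upwards [hd.eventually (lt_mem_nhds h2)] with m hm
  rw [if_pos hm]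

variable [IsProbabilityMeasure Q]

lemma measurable_prodBelow_gridBelow (hΔ : ∀ n, Measurable (Δ n)) {φ : ℝ → ℝ≥0∞}
    (hφ : Measurable φ) (m : ℕ) :
    Measurable fun ω => prodBelow Δ φ (gridBelow m (Δ 0 ω)) ω := by
  have h0 := hΔ 0
  refine Measurable.iInf fun K => Finset.measurable_prod _ fun n _ => ?_
  have hn := hΔ n
  exact Measurable.ite (measurableSet_lt hn (by fun_prop)) (by fun_prop) measurable_const

lemma measurable_iInf_prod_ratio (hΔ : ∀ n, Measurable (Δ n)) {φ : ℝ → ℝ≥0∞}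
    (hφ : Measurable φ) :
    Measurable fun ω => ⨅ K, ∏ n ∈ Finset.range K, φ (Δ (n + 1) ω / Δ 0 ω) := by
  refine Measurable.iInf fun K => Finset.measurable_prod _ fun n _ => ?_
  have h0 := hΔ 0
  have hn := hΔ (n + 1)
  fun_prop

/-- The conditional Laplace functional of the scaled jumps for a test function which only sees
finitely many jumps: the grid approximation of the largest jump is refined. -/
lemma IsStableJumps.lintegral_ratio_of_eq_one (h : IsStableJumps σ Q Δ) (hσ : 0 < σ)
    {φ : ℝ → ℝ≥0∞} (hφ : Measurable φ) (hφ1 : ∀ x, φ x ≤ 1) {ε : ℝ} (hε : 0 < ε)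
    (hφε : ∀ x < ε, φ x = 1) (hφc : ContinuousOn φ (Ioo 0 1)) {u : ℝ → ℝ≥0∞}
    (hu : Continuous u) {B : ℝ≥0∞} (hB : B ≠ ∞) (huB : ∀ x, u x ≤ B) :
    ∫⁻ ω, u (Δ 0 ω) * ⨅ K, ∏ n ∈ Finset.range K, φ (Δ (n + 1) ω / Δ 0 ω) ∂Q =
      ∫⁻ ω, u (Δ 0 ω) * expNeg (ENNReal.ofReal (Δ 0 ω ^ (-σ)) *
        ∫⁻ s in Iio 1, (1 - φ s) ∂(stableLevy σ)) ∂Q := by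
  have h0 := h.measurable 0
  have hum := hu.measurable
  have hfin : ∀ x, u x ≠ ∞ := fun x => ((huB x).trans_lt hB.lt_top).ne
  have hL : Tendsto (fun m => ∫⁻ ω, u (gridBelow m (Δ 0 ω)) *
      prodBelow Δ φ (gridBelow m (Δ 0 ω)) ω ∂Q) atTop
      (𝓝 (∫⁻ ω, u (Δ 0 ω) * ⨅ K, ∏ n ∈ Finset.range K, φ (Δ (n + 1) ω / Δ 0 ω) ∂Q)) := by
    refine tendsto_lintegral_of_dominated_convergence (fun _ => B) (fun m => ?_)
      (fun m => ae_of_all _ fun ω => ?_) (by simpa using hB) ?_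
    · have := measurable_prodBelow_gridBelow h.measurable hφ m
      fun_prop
    · exact (mul_le_of_le_one_right' (iInf_prod_range_le_one _)).trans (huB _)
    · filter_upwards [h.ae_pos, h.decreasing, h.ae_tendsto_zero hσ] with ω h1 h2 h3
      exact ENNReal.Tendsto.mul ((hu.tendsto _).comp (tendsto_gridBelow (h1 0)))
        (Or.inr ((iInf_prod_range_le_one _).trans_lt ENNReal.one_lt_top).ne)
        (tendsto_prodBelow hφ1 hε hφε hφc h1 h2 h3) (Or.inr (hfin _))
  refine tendsto_nhds_unique hL ?_
  simp_rw [h.lintegral_gridBelow hφ hφ1 u]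
  refine tendsto_lintegral_of_dominated_convergence (fun _ => B) (fun m => ?_)
    (fun m => ae_of_all _ fun ω => ?_) (by simpa using hB) ?_
  · fun_prop
  · exact (mul_le_of_le_one_right' (expNeg_le_one _)).trans (huB _)
  · filter_upwards [h.ae_pos] with ω h1
    have hd := tendsto_gridBelow (h1 0)
    refine ENNReal.Tendsto.mul ((hu.tendsto _).comp hd)
        (Or.inr ((expNeg_le_one _).trans_lt ENNReal.one_lt_top).ne)
        ((continuous_expNeg.tendsto _).comp (ENNReal.Tendsto.mul_const
          ((ENNReal.continuous_ofReal.tendsto _).comp ?_) (Or.inl ?_))) (Or.inr (hfin _))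
    · exact hd.rpow_const (Or.inl (h1 0).ne')
    · have := Real.rpow_pos_of_pos (h1 0) (-σ)
      simpa using this

/-- The truncation of `φ` which is `1` on `(-∞, 1 / (j + 1)]` and `φ` on `[2 / (j + 1), ∞)`. -/
def truncOne (φ : ℝ → ℝ≥0∞) (j : ℕ) (s : ℝ) : ℝ≥0∞ :=
  max (φ s) (min 1 (ENNReal.ofReal (2 - (j + 1) * s)))

lemma truncOne_eventually_eq (φ : ℝ → ℝ≥0∞) {s : ℝ} (hs : 0 < s) :
    ∀ᶠ j in atTop, truncOne φ j s = φ s := by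
  obtain ⟨k, hk⟩ := exists_nat_gt (2 / s)
  filter_upwards [eventually_ge_atTop k] with j hj
  have h1 : 2 < (j + 1) * s := by
    rw [div_lt_iff₀ hs] at hk
    have : (k : ℝ) ≤ j := by exact_mod_cast hj
    nlinarith
  rw [truncOne, ENNReal.ofReal_of_nonpos (by linarith)]
  simp

lemma truncOne_le_one {φ : ℝ → ℝ≥0∞} (hφ1 : ∀ x, φ x ≤ 1) (j : ℕ) (s : ℝ) :
    truncOne φ j s ≤ 1 := max_le (hφ1 s) (min_le_left _ _)

lemma truncOne_antitone (φ : ℝ → ℝ≥0∞) {s : ℝ} (hs : 0 < s) :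
    Antitone fun j => truncOne φ j s := by
  intro i j hij
  have : (i : ℝ) ≤ j := by exact_mod_cast hij
  refine max_le_max le_rfl (min_le_min le_rfl (ENNReal.ofReal_le_ofReal ?_))
  gcongr

/-- The conditional Laplace functional of the scaled jumps: given `Δ 0 = t`, the points
`Δ (n + 1) / Δ 0` form a Poisson process with intensity `t ^ (-σ) ν` on `(0, 1)`. -/
theorem IsStableJumps.lintegral_ratio (h : IsStableJumps σ Q Δ) (hσ : 0 < σ)
    {φ : ℝ → ℝ≥0∞} (hφ : Measurable φ) (hφ1 : ∀ x, φ x ≤ 1) (hφc : ContinuousOn φ (Ioo 0 1))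
    (hI : ∫⁻ s in Iio 1, (1 - φ s) ∂(stableLevy σ) ≠ ∞) {u : ℝ → ℝ≥0∞} (hu : Measurable u) :
    ∫⁻ ω, u (Δ 0 ω) * ⨅ K, ∏ n ∈ Finset.range K, φ (Δ (n + 1) ω / Δ 0 ω) ∂Q =
      ∫⁻ ω, u (Δ 0 ω) * expNeg (ENNReal.ofReal (Δ 0 ω ^ (-σ)) *
        ∫⁻ s in Iio 1, (1 - φ s) ∂(stableLevy σ)) ∂Q := by
  have h0 := h.measurable 0
  have hcont : ∀ (u : ℝ → ℝ≥0∞), Continuous u → ∀ B : ℝ≥0∞, B ≠ ∞ → (∀ x, u x ≤ B) →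
      ∫⁻ ω, u (Δ 0 ω) * ⨅ K, ∏ n ∈ Finset.range K, φ (Δ (n + 1) ω / Δ 0 ω) ∂Q =
      ∫⁻ ω, u (Δ 0 ω) * expNeg (ENNReal.ofReal (Δ 0 ω ^ (-σ)) *
        ∫⁻ s in Iio 1, (1 - φ s) ∂(stableLevy σ)) ∂Q := by
    intro u hu B hB huB
    have hum := hu.measurable
    have hfin : ∀ x, u x ≠ ∞ := fun x => ((huB x).trans_lt hB.lt_top).ne
    have htm : ∀ j, Measurable (truncOne φ j) := fun j => by unfold truncOne; fun_prop
    have hj : ∀ j, _ := fun j : ℕ => h.lintegral_ratio_of_eq_one hσ (htm j)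
      (truncOne_le_one hφ1 j) (ε := 1 / (j + 1)) (by positivity)
      (by
        intro x hx
        rw [lt_div_iff₀ (by positivity)] at hx
        refine le_antisymm (truncOne_le_one hφ1 j x) ?_
        refine le_max_of_le_right (le_min le_rfl ?_)
        rw [ENNReal.one_le_ofReal]
        linarith)
      (by
        unfold truncOne
        exact hφc.sup (continuous_const.min
          (ENNReal.continuous_ofReal.comp (by fun_prop))).continuousOn)
      hu hB huB
    have hL : Tendsto (fun j => ∫⁻ ω, u (Δ 0 ω) *
        ⨅ K, ∏ n ∈ Finset.range K, truncOne φ j (Δ (n + 1) ω / Δ 0 ω) ∂Q) atTop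
        (𝓝 (∫⁻ ω, u (Δ 0 ω) * ⨅ K, ∏ n ∈ Finset.range K, φ (Δ (n + 1) ω / Δ 0 ω) ∂Q)) := by
      refine tendsto_lintegral_of_dominated_convergence (fun _ => B) (fun m => ?_)
        (fun m => ae_of_all _ fun ω => ?_) (by simpa using hB) ?_
      · have := measurable_iInf_prod_ratio h.measurable (htm m)
        fun_prop
      · exact (mul_le_of_le_one_right' (iInf_prod_range_le_one _)).trans (huB _)
      · filter_upwards [h.ae_pos] with ω h1
        have hr : ∀ n, 0 < Δ (n + 1) ω / Δ 0 ω := fun n => div_pos (h1 _) (h1 _)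
        refine ENNReal.Tendsto.const_mul ?_ (Or.inr (hfin _))
        have hanti : ∀ K, Antitone fun j =>
            ∏ n ∈ Finset.range K, truncOne φ j (Δ (n + 1) ω / Δ 0 ω) := fun K i j hij =>
          Finset.prod_le_prod' fun n _ => truncOne_antitone φ (hr n) hij
        have hlim : ∀ K, ⨅ j, ∏ n ∈ Finset.range K, truncOne φ j (Δ (n + 1) ω / Δ 0 ω) =
            ∏ n ∈ Finset.range K, φ (Δ (n + 1) ω / Δ 0 ω) := by
          intro K
          refine tendsto_nhds_unique (tendsto_atTop_iInf (hanti K)) ?_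
          refine tendsto_const_nhds.congr' ?_
          have : ∀ᶠ j in atTop, ∀ n ∈ Finset.range K, truncOne φ j (Δ (n + 1) ω / Δ 0 ω) =
              φ (Δ (n + 1) ω / Δ 0 ω) :=
            (Finset.eventually_all _).2 fun n _ => truncOne_eventually_eq φ (hr n)
          filter_upwards [this] with j hj
          exact (Finset.prod_congr rfl hj).symm
        simp_rw [← hlim]
        rw [iInf_comm]
        exact tendsto_atTop_iInf fun i j hij => iInf_mono fun K => hanti K hij
    refine tendsto_nhds_unique hL ?_
    simp_rw [hj]
    have hIlim : Tendsto (fun j => ∫⁻ s in Iio 1, (1 - truncOne φ j s) ∂(stableLevy σ)) atTop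
        (𝓝 (∫⁻ s in Iio 1, (1 - φ s) ∂(stableLevy σ))) := by
      refine tendsto_lintegral_of_dominated_convergence (fun s => 1 - φ s)
        (fun j => by have := htm j; fun_prop) (fun j => ae_of_all _ fun s => ?_) hI ?_
      · exact tsub_le_tsub_left (le_max_left _ _) _
      · filter_upwards [ae_restrict_of_ae (ae_stableLevy_pos σ)] with s hs
        refine tendsto_const_nhds.congr' ?_
        filter_upwards [truncOne_eventually_eq φ hs] with j hj
        rw [hj]
    refine tendsto_lintegral_of_dominated_convergence (fun _ => B) (fun m => ?_)
      (fun m => ae_of_all _ fun ω => ?_) (by simpa using hB) (ae_of_all _ fun ω => ?_)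
    · fun_prop
    · exact (mul_le_of_le_one_right' (expNeg_le_one _)).trans (huB _)
    · exact ENNReal.Tendsto.const_mul ((continuous_expNeg.tendsto _).comp
        (ENNReal.Tendsto.const_mul hIlim (Or.inr ENNReal.ofReal_ne_top))) (Or.inr (hfin _))
  set F : Ω → ℝ≥0∞ := fun ω => ⨅ K, ∏ n ∈ Finset.range K, φ (Δ (n + 1) ω / Δ 0 ω)
  set F' : Ω → ℝ≥0∞ := fun ω => expNeg (ENNReal.ofReal (Δ 0 ω ^ (-σ)) *
        ∫⁻ s in Iio 1, (1 - φ s) ∂(stableLevy σ))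
  have hF : Measurable F := measurable_iInf_prod_ratio h.measurable hφ
  have hF' : Measurable F' := by fun_prop
  have hmap : ∀ (G : Ω → ℝ≥0∞), Measurable G → ∀ u : ℝ → ℝ≥0∞, Measurable u →
      ∫⁻ x, u x ∂((Q.withDensity G).map (Δ 0)) = ∫⁻ ω, u (Δ 0 ω) * G ω ∂Q := by
    intro G hG u hu
    rw [lintegral_map hu h0, lintegral_withDensity_eq_lintegral_mul _ hG (by fun_prop)]
    simp [mul_comm]
  have hfinite : ∀ (G : Ω → ℝ≥0∞), (∀ ω, G ω ≤ 1) → IsFiniteMeasure ((Q.withDensity G)) := by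
    intro G hG
    refine isFiniteMeasure_withDensity ?_
    refine ((lintegral_mono hG).trans_lt ?_).ne
    simp
  have := hfinite F fun ω => iInf_prod_range_le_one _
  have := hfinite F' fun ω => expNeg_le_one _
  have hmeas : (Q.withDensity F).map (Δ 0) = (Q.withDensity F').map (Δ 0) := by
    refine ext_of_forall_lintegral_eq_of_IsFiniteMeasure fun f => ?_
    rw [hmap F hF _ (by fun_prop), hmap F' hF' _ (by fun_prop)]
    exact hcont (fun x => f x) (by fun_prop) (nndist f 0 : ℝ≥0∞) ENNReal.coe_ne_top
      fun x => ENNReal.coe_le_coe.2 (BoundedContinuousFunction.NNReal.upper_bound f x)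
  rw [← hmap F hF u hu, hmeas, hmap F' hF' u hu]

end Jumps

/-! ### Powers of gamma variables -/

/-- If `V` has a gamma law, this is the density of `V ^ (-1 / σ)`. -/
lemma map_gammaMeasure_rpow {σ : ℝ} (hσ : 0 < σ) (a b : ℝ) :
    (gammaMeasure a b).map (fun v => v ^ (-1 / σ)) =
      (volume.restrict (Ioi 0)).withDensity fun η => ENNReal.ofReal
        (b ^ a / Real.Gamma a * σ * (Real.exp (-(η ^ (-σ) * b)) * η ^ (-σ * a - 1))) := by
  have hpdf : Measurable (gammaPDF a b) := (measurable_gammaPDFReal a b).ennreal_ofReal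
  have himg : (fun x : ℝ => x ^ (-σ)) '' Ioi 0 = Ioi 0 := by
    ext y
    constructor
    · rintro ⟨x, hx, rfl⟩
      exact Real.rpow_pos_of_pos hx _
    · intro hy
      refine ⟨y ^ (-1 / σ), Real.rpow_pos_of_pos hy _, ?_⟩
      simp only
      rw [← Real.rpow_mul (le_of_lt hy), show -1 / σ * -σ = 1 by field_simp, Real.rpow_one]
  have hinj : InjOn (fun x : ℝ => x ^ (-σ)) (Ioi 0) := by
    intro x hx y hy hxy
    exact (Real.rpow_left_inj (le_of_lt hx) (le_of_lt hy) (by linarith)).1 hxy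
  refine Measure.ext_of_lintegral _ fun f hf => ?_
  rw [lintegral_map hf (by fun_prop), gammaMeasure,
    lintegral_withDensity_eq_lintegral_mul _ hpdf (by fun_prop),
    lintegral_withDensity_eq_lintegral_mul _ (by fun_prop) hf]
  have h1 : ∫⁻ v, (gammaPDF a b * fun v => f (v ^ (-1 / σ))) v =
      ∫⁻ v in Ioi 0, gammaPDF a b v * f (v ^ (-1 / σ)) := by
    rw [← lintegral_indicator measurableSet_Ioi]
    refine lintegral_congr_ae ?_
    filter_upwards [compl_mem_ae_iff.2 (measure_singleton (0 : ℝ))] with v hv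
    rcases lt_trichotomy v 0 with h | h | h
    · simp [indicator_of_notMem (show v ∉ Ioi 0 from not_lt.2 h.le), gammaPDF_of_neg h]
    · exact absurd h hv
    · simp [indicator_of_mem (show v ∈ Ioi 0 from h)]
  have h2 := lintegral_image_eq_lintegral_abs_deriv_mul measurableSet_Ioi
    (fun x (hx : x ∈ Ioi (0 : ℝ)) =>
      (Real.hasDerivAt_rpow_const (p := -σ) (Or.inl (ne_of_gt hx))).hasDerivWithinAt) hinj
    (fun v => gammaPDF a b v * f (v ^ (-1 / σ)))
  rw [himg] at h2
  rw [h1, h2]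
  refine setLIntegral_congr_fun measurableSet_Ioi fun x hx => ?_
  have hx' : 0 < x := hx
  have hp : 0 < x ^ (-σ) := Real.rpow_pos_of_pos hx' _
  simp only [Pi.mul_apply]
  have hinv : (x ^ (-σ)) ^ (-1 / σ) = x := by
    rw [← Real.rpow_mul hx'.le, show -σ * (-1 / σ) = 1 by field_simp, Real.rpow_one]
  rw [hinv, gammaPDF_of_nonneg hp.le, ← mul_assoc, ← ENNReal.ofReal_mul (abs_nonneg _)]
  congr 2
  rw [abs_mul, abs_neg, abs_of_pos hσ, abs_of_pos (Real.rpow_pos_of_pos hx' _),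
    ← Real.rpow_mul hx'.le,
    show -σ * a - 1 = (-σ - 1) + -σ * (a - 1) by ring, Real.rpow_add hx', mul_comm b]
  ring

/-- The Laplace transform of a gamma law. -/
lemma lintegral_exp_gammaMeasure {a b l : ℝ} (ha : 0 < a) (hb : 0 < b) (hl : 0 ≤ l) :
    ∫⁻ v, ENNReal.ofReal (Real.exp (-(l * v))) ∂(gammaMeasure a b) =
      ENNReal.ofReal ((b / (b + l)) ^ a) := by
  have hpdf : Measurable (gammaPDF a b) := (measurable_gammaPDFReal a b).ennreal_ofReal
  rw [gammaMeasure, lintegral_withDensity_eq_lintegral_mul _ hpdf (by fun_prop)]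
  have h1 : ∀ v, (gammaPDF a b * fun v => ENNReal.ofReal (Real.exp (-(l * v)))) v =
      ENNReal.ofReal ((b / (b + l)) ^ a) * gammaPDF a (b + l) v := by
    intro v
    simp only [Pi.mul_apply]
    rcases lt_or_ge v 0 with h | h
    · simp [gammaPDF_of_neg h]
    · rw [gammaPDF_of_nonneg h, gammaPDF_of_nonneg h, ← ENNReal.ofReal_mul (by positivity),
        ← ENNReal.ofReal_mul (by positivity), Real.div_rpow hb.le (by positivity)]
      congr 1
      have : Real.exp (-((b + l) * v)) = Real.exp (-(b * v)) * Real.exp (-(l * v)) := by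
        rw [← Real.exp_add]; ring_nf
      rw [this]
      have h3 : (b + l) ^ a ≠ 0 := (Real.rpow_pos_of_pos (by positivity) _).ne'
      field_simp
  simp_rw [h1]
  have hpdf' : Measurable (gammaPDF a (b + l)) := (measurable_gammaPDFReal a _).ennreal_ofReal
  rw [lintegral_const_mul _ hpdf',
    lintegral_gammaPDF_eq_one ha (by positivity), mul_one]

lemma ae_gammaMeasure_pos (a b : ℝ) : ∀ᵐ v ∂(gammaMeasure a b), 0 < v := by
  have hpdf : Measurable (gammaPDF a b) := (measurable_gammaPDFReal a b).ennreal_ofReal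
  rw [gammaMeasure, ae_withDensity_iff hpdf]
  filter_upwards [compl_mem_ae_iff.2 (measure_singleton (0 : ℝ))] with v hv h
  rcases lt_trichotomy v 0 with h' | h' | h'
  · exact absurd (gammaPDF_of_neg h') h
  · exact absurd h' hv
  · exact h'

/-- The tilt turns the exponential law of `Δ 0 ^ (-σ)` into a gamma law. -/
lemma tiltedJumpLaw_eq {σ β c : ℝ} (hσ : 0 < σ) :
    tiltedJumpLaw σ β c = (gammaMeasure (c + 1) β).map fun v => v ^ (-1 / σ) := by
  rw [map_gammaMeasure_rpow hσ, tiltedJumpLaw, ← withDensity_indicator measurableSet_Ioi]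
  congr 1
  ext s
  by_cases hs : 0 < s
  · rw [indicator_of_mem (mem_Ioi.2 hs), tilt, largestJumpDensity, if_pos hs]
    congr 1
    rw [show -(β - 1) * s ^ (-σ) = -(s ^ (-σ) * β) + s ^ (-σ) by ring, Real.exp_add,
      show -σ * (c + 1) - 1 = -c * σ + (-1 - σ) by ring, Real.rpow_add hs, Real.exp_neg (s ^ (-σ))]
    have := (Real.exp_pos (s ^ (-σ))).ne'
    field_simp
  · rw [indicator_of_notMem (show s ∉ Ioi 0 from hs), largestJumpDensity, if_neg hs, mul_zero, ENNReal.ofReal_zero]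

lemma withDensity_largestJumpDensity {σ : ℝ} (hσ : 0 < σ) :
    volume.withDensity (fun s => ENNReal.ofReal (largestJumpDensity σ s)) =
      (gammaMeasure 1 1).map fun v => v ^ (-1 / σ) := by
  rw [map_gammaMeasure_rpow hσ, ← withDensity_indicator measurableSet_Ioi]
  congr 1
  ext s
  by_cases hs : 0 < s
  · rw [indicator_of_mem (mem_Ioi.2 hs), largestJumpDensity, if_pos hs]
    congr 1
    rw [show -σ * 1 - 1 = -1 - σ by ring]
    simp
    ring
  · rw [indicator_of_notMem (show s ∉ Ioi 0 from hs), largestJumpDensity, if_neg hs, ENNReal.ofReal_zero]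

section Jumps

variable {Ω : Type*} [MeasurableSpace Ω] {σ : ℝ} {Q : Measure Ω} {Δ : ℕ → Ω → ℝ}
  [IsProbabilityMeasure Q]

lemma measurable_largestJumpDensity (σ : ℝ) : Measurable (largestJumpDensity σ) :=
  Measurable.ite measurableSet_Ioi (by fun_prop) measurable_const

/-- The largest jump is at most `b` if there is no jump in `(b, ∞)`. -/
lemma IsStableJumps.measure_largest_le (h : IsStableJumps σ Q Δ) {b : ℝ} :
    Q.map (Δ 0) (Iic b) = expNeg (stableLevy σ (Ioi b)) := by
  have h1 := h.poisson.lintegral_iInf_prod (φ := (Iic b).indicator 1)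
    (measurable_one.indicator measurableSet_Iic) (fun x => indicator_le_self' (by simp) x)
  have h2 : ∫⁻ s, (1 - (Iic b).indicator 1 s) ∂(stableLevy σ) = stableLevy σ (Ioi b) := by
    rw [← lintegral_indicator_one measurableSet_Ioi]
    refine lintegral_congr fun s => ?_
    by_cases hs : s ≤ b
    · simp [hs]
    · simp [hs, not_le.1 hs]
  rw [h2] at h1
  rw [← h1, Measure.map_apply (h.measurable 0) measurableSet_Iic,
    ← lintegral_indicator_one (h.measurable 0 measurableSet_Iic)]
  refine lintegral_congr_ae ?_
  filter_upwards [h.decreasing] with ω hω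
  by_cases h0 : Δ 0 ω ≤ b
  · have : ∀ n, Δ n ω ≤ b := fun n => (hω.antitone (Nat.zero_le n)).trans h0
    simp [this]
  · refine le_antisymm ?_ ((iInf_le _ 1).trans ?_)
    · simp [h0]
    · simp [h0]

/-- The law of the largest jump. -/
theorem IsStableJumps.map_largest (h : IsStableJumps σ Q Δ) (hσ : 0 < σ) :
    Q.map (Δ 0) = volume.withDensity fun s => ENNReal.ofReal (largestJumpDensity σ s) := by
  set μ := volume.withDensity fun s => ENNReal.ofReal (largestJumpDensity σ s) with hμ
  have hprob : IsProbabilityMeasure μ := by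
    rw [hμ, withDensity_largestJumpDensity hσ]
    have := isProbabilityMeasure_gammaMeasure one_pos one_pos
    exact Measure.isProbabilityMeasure_map (by fun_prop)
  have : IsProbabilityMeasure (Q.map (Δ 0)) :=
    Measure.isProbabilityMeasure_map (h.measurable 0).aemeasurable
  refine Measure.ext_of_Iic _ _ fun b => ?_
  rcases le_or_gt b 0 with hb | hb
  · have h1 : Q.map (Δ 0) (Iic b) = 0 := by
      rw [Measure.map_apply (h.measurable 0) measurableSet_Iic]
      refine measure_mono_null ?_ (ae_iff.1 h.ae_pos)
      intro ω hω h'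
      exact not_lt.2 (le_trans hω hb) (h' 0)
    rw [h1, hμ, withDensity_apply _ measurableSet_Iic, eq_comm,
      setLIntegral_eq_zero_iff measurableSet_Iic (measurable_largestJumpDensity σ).ennreal_ofReal]
    refine ae_of_all _ fun s hs => ?_
    show ENNReal.ofReal (largestJumpDensity σ s) = 0
    rw [largestJumpDensity, if_neg (not_lt.2 (le_trans hs hb)), ENNReal.ofReal_zero]
  · have h1 : μ (Ioi b) = ENNReal.ofReal (1 - Real.exp (-b ^ (-σ))) := by
      have hd : ∀ x ∈ Ici b, HasDerivAt (fun x => Real.exp (-x ^ (-σ))) (largestJumpDensity σ x) x := by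
        intro x hx
        have hx' : 0 < x := hb.trans_le hx
        have h2 : HasDerivAt (fun x : ℝ => -x ^ (-σ)) (-(-σ * x ^ (-σ - 1))) x :=
          (Real.hasDerivAt_rpow_const (p := -σ) (Or.inl hx'.ne')).neg
        refine h2.exp.congr_deriv ?_
        rw [largestJumpDensity, if_pos hx', show -σ - 1 = -1 - σ by ring]
        ring
      have hn : ∀ x, 0 ≤ largestJumpDensity σ x := by
        intro x
        unfold largestJumpDensity
        split_ifs
        · positivity
        · exact le_rfl
      have hl : Tendsto (fun x : ℝ => Real.exp (-x ^ (-σ))) atTop (𝓝 1) := by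
        have := (Real.continuous_exp.tendsto _).comp (tendsto_rpow_neg_atTop hσ).neg
        simpa [Function.comp_def] using this
      rw [hμ, withDensity_apply _ measurableSet_Ioi, ← ofReal_integral_eq_lintegral_ofReal
        (integrableOn_Ioi_deriv_of_nonneg' hd (fun x _ => hn x) hl) (ae_of_all _ hn),
        integral_Ioi_of_hasDerivAt_of_nonneg' hd (fun x _ => hn x) hl]
    rw [h.measure_largest_le, stableLevy_Ioi hσ hb, expNeg_ofReal (by positivity), ← compl_Ioi,
      measure_compl measurableSet_Ioi (measure_ne_top _ _), measure_univ, h1, ← ENNReal.ofReal_one,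
      ← ENNReal.ofReal_sub _ (by simp; positivity)]
    congr 1
    ring

end Jumps

/-! ### The function `ψ` as an integral -/

lemma one_sub_one_sub_rpow_le {a s : ℝ} (ha : 0 ≤ a) (h0 : 0 ≤ s) (h1 : s ≤ 1) :
    1 - (1 - s) ^ a ≤ max a 1 * s := by
  rcases le_total 1 a with h | h
  · have := one_add_mul_self_le_rpow_one_add (s := -s) (by linarith) h
    rw [max_eq_left h, ← sub_eq_add_neg] at *
    linarith
  · have := Real.rpow_le_rpow_of_exponent_ge' (x := 1 - s) (by linarith) (by linarith) ha h
    rw [Real.rpow_one] at this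
    rw [max_eq_right h]
    linarith

/-- Euler's beta integral, from the normalization of the beta density. -/
lemma integral_beta {u v : ℝ} (hu : 0 < u) (hv : 0 < v) :
    IntegrableOn (fun x : ℝ => x ^ (u - 1) * (1 - x) ^ (v - 1)) (Ioo 0 1) ∧
      ∫ x in Ioo (0 : ℝ) 1, x ^ (u - 1) * (1 - x) ^ (v - 1) = ProbabilityTheory.beta u v := by
  have hb := beta_pos hu hv
  have h1 := lintegral_betaPDF_eq_one hu hv
  rw [lintegral_betaPDF] at h1
  have hnn : 0 ≤ᵐ[volume.restrict (Ioo (0 : ℝ) 1)]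
      fun x => 1 / ProbabilityTheory.beta u v * x ^ (u - 1) * (1 - x) ^ (v - 1) := by
    filter_upwards [ae_restrict_mem measurableSet_Ioo] with x hx
    have h2 : 0 ≤ x := hx.1.le
    have h3 : 0 ≤ 1 - x := by linarith [hx.2]
    simp only [Pi.zero_apply]
    positivity
  have hint : IntegrableOn (fun x => 1 / ProbabilityTheory.beta u v * x ^ (u - 1) *
      (1 - x) ^ (v - 1)) (Ioo (0 : ℝ) 1) := by
    refine ⟨by fun_prop, ?_⟩
    rw [hasFiniteIntegral_iff_ofReal hnn, h1]
    exact ENNReal.one_lt_top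
  have hval : ∫ x in Ioo (0 : ℝ) 1, 1 / ProbabilityTheory.beta u v * x ^ (u - 1) *
      (1 - x) ^ (v - 1) = 1 := by
    rw [integral_eq_lintegral_of_nonneg_ae hnn hint.1, h1, ENNReal.toReal_one]
  have heq : (fun x : ℝ => x ^ (u - 1) * (1 - x) ^ (v - 1)) = fun x =>
      ProbabilityTheory.beta u v *
        (1 / ProbabilityTheory.beta u v * x ^ (u - 1) * (1 - x) ^ (v - 1)) := by
    ext x
    field_simp
  rw [heq]
  refine ⟨hint.const_mul _, ?_⟩
  rw [integral_const_mul, hval, mul_one]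

/-- Integration by parts, which removes the singularity of the stable Lévy measure at `0`. -/
lemma integral_one_sub_rpow {σ a : ℝ} (hσ : σ ∈ Ioo (0 : ℝ) 1) (ha : 0 < a) :
    IntegrableOn (fun s : ℝ => σ * s ^ (-1 - σ) * (1 - (1 - s) ^ a)) (Ioo 0 1) ∧
      ∫ s in Ioo (0 : ℝ) 1, σ * s ^ (-1 - σ) * (1 - (1 - s) ^ a) =
        a * ProbabilityTheory.beta (1 - σ) a - 1 := by
  obtain ⟨hσ0, hσ1⟩ := hσ
  obtain ⟨hB, hBv⟩ := integral_beta (u := 1 - σ) (by linarith) ha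
  rw [show 1 - σ - 1 = -σ by ring] at hB hBv
  have hA : IntegrableOn (fun s : ℝ => σ * s ^ (-1 - σ) * (1 - (1 - s) ^ a)) (Ioo 0 1) := by
    have h1 : IntegrableOn (fun s : ℝ => σ * max a 1 * s ^ (-σ)) (Ioo 0 1) := by
      have := intervalIntegral.intervalIntegrable_rpow' (a := 0) (b := 1) (r := -σ) (by linarith)
      rw [intervalIntegrable_iff_integrableOn_Ioo_of_le zero_le_one] at this
      exact this.const_mul _
    refine h1.mono' (by fun_prop) ?_
    filter_upwards [ae_restrict_mem measurableSet_Ioo] with s hs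
    have h2 := one_sub_one_sub_rpow_le ha.le hs.1.le hs.2.le
    have h3 : (1 - s) ^ a ≤ 1 := Real.rpow_le_one (by linarith [hs.2]) (by linarith [hs.1]) ha.le
    have h4 : 0 < s ^ (-1 - σ) := Real.rpow_pos_of_pos hs.1 _
    rw [Real.norm_of_nonneg (mul_nonneg (by positivity) (by linarith)),
      show -σ = (-1 - σ) + 1 by ring, Real.rpow_add_one hs.1.ne']
    calc σ * s ^ (-1 - σ) * (1 - (1 - s) ^ a) ≤ σ * s ^ (-1 - σ) * (max a 1 * s) := by gcongr
      _ = _ := by ring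
  refine ⟨hA, ?_⟩
  set f : ℝ → ℝ := fun s => -(s ^ (-σ) * (1 - (1 - s) ^ a)) with hf
  set f' : ℝ → ℝ := fun s => σ * s ^ (-1 - σ) * (1 - (1 - s) ^ a) -
    a * (s ^ (-σ) * (1 - s) ^ (a - 1)) with hf'
  have hd : ∀ s ∈ Ioo (0 : ℝ) 1, HasDerivAt f (f' s) s := by
    intro s hs
    have h1 : HasDerivAt (fun s : ℝ => s ^ (-σ)) (-σ * s ^ (-σ - 1)) s :=
      Real.hasDerivAt_rpow_const (Or.inl hs.1.ne')
    have h2 : HasDerivAt (fun s : ℝ => (1 - s) ^ a) (-1 * a * (1 - s) ^ (a - 1)) s :=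
      ((hasDerivAt_id s).const_sub 1).rpow_const (Or.inl (by simp; linarith [hs.2]))
    refine (h1.mul (h2.const_sub 1)).neg.congr_deriv ?_
    rw [hf', show -σ - 1 = -1 - σ by ring]
    ring
  have hi : IntervalIntegrable f' volume 0 1 := by
    rw [intervalIntegrable_iff_integrableOn_Ioo_of_le zero_le_one]
    exact hA.sub (hB.const_mul a)
  have h0 : Tendsto f (𝓝[>] 0) (𝓝 0) := by
    have h1 : Tendsto (fun s : ℝ => max a 1 * s ^ (1 - σ)) (𝓝[>] 0) (𝓝 0) := by
      have : ContinuousAt (fun s : ℝ => max a 1 * s ^ (1 - σ)) 0 :=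
        (Real.continuousAt_rpow_const _ _ (Or.inr (by linarith))).const_mul _
      have := this.tendsto.mono_left (nhdsWithin_le_nhds (s := Ioi 0))
      rwa [Real.zero_rpow (by linarith), mul_zero] at this
    refine squeeze_zero_norm' ?_ h1
    filter_upwards [Ioo_mem_nhdsGT (zero_lt_one (α := ℝ))] with s hs
    have h2 := one_sub_one_sub_rpow_le ha.le hs.1.le hs.2.le
    have h3 : (1 - s) ^ a ≤ 1 := Real.rpow_le_one (by linarith [hs.2]) (by linarith [hs.1]) ha.le
    have h4 : 0 < s ^ (-σ) := Real.rpow_pos_of_pos hs.1 _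
    rw [hf, norm_neg, Real.norm_of_nonneg (mul_nonneg h4.le (by linarith)),
      show 1 - σ = -σ + 1 by ring, Real.rpow_add_one hs.1.ne']
    calc s ^ (-σ) * (1 - (1 - s) ^ a) ≤ s ^ (-σ) * (max a 1 * s) := by gcongr
      _ = _ := by ring
  have h1 : Tendsto f (𝓝[<] 1) (𝓝 (-1)) := by
    have hc : ContinuousAt f 1 := by
      refine ContinuousAt.neg (ContinuousAt.mul ?_ (continuousAt_const.sub ?_))
      · exact Real.continuousAt_rpow_const _ _ (Or.inl one_ne_zero)
      · exact (continuousAt_const.sub continuousAt_id).rpow_const (Or.inr ha.le)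
    have := hc.tendsto.mono_left (nhdsWithin_le_nhds (s := Iio 1))
    simpa [hf, Real.zero_rpow ha.ne'] using this
  have key := intervalIntegral.integral_eq_sub_of_hasDerivAt_of_tendsto zero_lt_one hd hi h0 h1
  rw [intervalIntegral.integral_of_le zero_le_one, integral_Ioc_eq_integral_Ioo, hf',
    integral_sub hA (hB.const_mul a), integral_const_mul, hBv] at key
  linarith

/-- The functional equation of `Γ` moves the negative argument `-σ` of the beta function to
`1 - σ`. -/
lemma psi_zero_left {σ r y : ℝ} (hσ : σ ∈ Ioo (0 : ℝ) 1) (ha : 0 < r * y) :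
    psi σ r 0 y = r * y * ProbabilityTheory.beta (1 - σ) (r * y) - 1 := by
  obtain ⟨hσ0, hσ1⟩ := hσ
  unfold psi ProbabilityTheory.beta
  set a := r * y with haa
  have h1 : Real.Gamma (1 - σ) = -σ * Real.Gamma (-σ) := by
    rw [← Real.Gamma_add_one (by linarith), neg_add_eq_sub]
  have h2 : Real.Gamma (-σ) ≠ 0 := by
    intro h
    have := Real.Gamma_pos_of_pos (show 0 < 1 - σ by linarith)
    rw [h1, h, mul_zero] at this
    exact lt_irrefl _ this
  rw [mul_zero, zero_add, zero_add, ← haa, Real.Gamma_one, Real.Gamma_add_one ha.ne',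
    show 1 + -σ = 1 - σ by ring, show a + 1 + -σ = 1 - σ + a by ring, h1]
  have h3 := (Real.Gamma_pos_of_pos (show 0 < 1 - σ + a by linarith)).ne'
  field_simp
  ring

lemma one_sub_ofReal {x : ℝ} (hx : 0 ≤ x) :
    1 - ENNReal.ofReal x = ENNReal.ofReal (1 - x) := by
  rw [ENNReal.ofReal_sub _ hx, ENNReal.ofReal_one]

/-- `ψ_0^{(y)}` is the mass that the stable Lévy measure, thinned by the probability
`1 - (1 - s) ^ (r y)` that a unit of rate `s` is observed, gives to `(0, 1)`. -/
theorem lintegral_one_sub_rpow {σ r y : ℝ} (hσ : σ ∈ Ioo (0 : ℝ) 1) (ha : 0 ≤ r * y) :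
    0 ≤ psi σ r 0 y ∧
    ∫⁻ s in Iio 1, (1 - ENNReal.ofReal ((1 - s) ^ (r * y))) ∂(stableLevy σ) =
      ENNReal.ofReal (psi σ r 0 y) := by
  have h0 : ∫⁻ s in Iio 1, (1 - ENNReal.ofReal ((1 - s) ^ (r * y))) ∂(stableLevy σ) =
      ∫⁻ s in Ioo 0 1, ENNReal.ofReal (σ * s ^ (-1 - σ) * (1 - (1 - s) ^ (r * y))) := by
    rw [← lintegral_indicator measurableSet_Iio, lintegral_stableLevy _
      (Measurable.indicator (by fun_prop) measurableSet_Iio),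
      ← lintegral_indicator measurableSet_Ioi, ← lintegral_indicator measurableSet_Ioo]
    refine lintegral_congr fun s => ?_
    by_cases hs0 : 0 < s
    · by_cases hs1 : s < 1
      · have h1 : 0 ≤ 1 - s := by linarith
        rw [indicator_of_mem (mem_Ioi.2 hs0), indicator_of_mem (mem_Iio.2 hs1),
          indicator_of_mem (mem_Ioo.2 ⟨hs0, hs1⟩), one_sub_ofReal (by positivity),
          ← ENNReal.ofReal_mul (mul_nonneg hσ.1.le (by positivity))]
      · simp [hs0, hs1]
    · simp [hs0]
  have hnn : 0 ≤ᵐ[volume.restrict (Ioo (0 : ℝ) 1)]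
      fun s => σ * s ^ (-1 - σ) * (1 - (1 - s) ^ (r * y)) := by
    filter_upwards [ae_restrict_mem measurableSet_Ioo] with s hs
    have h3 : (1 - s) ^ (r * y) ≤ 1 := Real.rpow_le_one (by linarith [hs.2]) (by linarith [hs.1]) ha
    have h4 : 0 < s ^ (-1 - σ) := Real.rpow_pos_of_pos hs.1 _
    exact mul_nonneg (mul_nonneg hσ.1.le h4.le) (by linarith)
  rw [h0]
  rcases ha.eq_or_lt with ha | ha
  · rw [← ha]
    simp [psi, mul_zero, zero_add, ← ha]
  · obtain ⟨hA, hAv⟩ := integral_one_sub_rpow hσ ha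
    rw [← ofReal_integral_eq_lintegral_ofReal hA hnn, hAv, psi_zero_left hσ ha]
    exact ⟨hAv ▸ integral_nonneg_of_ae hnn, rfl⟩

/-! ### Generating functions of the counts -/

/-- The probability generating function at `z ∈ [0, 1]` of `negBin r s`, for `r > 0`. The value `1`
outside of `0 ≤ s < 1` is that of the point mass at `0`. -/
def nbGen (r s z : ℝ) : ℝ := if 0 ≤ s ∧ s < 1 then ((1 - s) / (1 - s * z)) ^ r else 1

lemma nbGen_of_mem {r s z : ℝ} (hs : s ∈ Ioo (0 : ℝ) 1) :
    nbGen r s z = ((1 - s) / (1 - s * z)) ^ r := if_pos ⟨hs.1.le, hs.2⟩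

lemma one_sub_mul_pos {s z : ℝ} (h0 : 0 ≤ s) (h1 : s < 1) (hz : z ≤ 1) : 0 < 1 - s * z := by
  nlinarith

lemma nbGen_mono {r s : ℝ} (hr : 0 ≤ r) {z z' : ℝ} (hz' : z' ≤ 1) (hzz' : z ≤ z') :
    nbGen r s z ≤ nbGen r s z' := by
  unfold nbGen
  split_ifs with h
  · have h1 := one_sub_mul_pos h.1 h.2 hz'
    have h2 := one_sub_mul_pos h.1 h.2 (hzz'.trans hz')
    have h3 : 0 ≤ 1 - s := by linarith
    refine Real.rpow_le_rpow (div_nonneg h3 h2.le) ?_ hr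
    refine div_le_div_of_nonneg_left h3 h1 ?_
    nlinarith
  · exact le_rfl

lemma nbGen_one {r s : ℝ} : nbGen r s 1 = 1 := by
  unfold nbGen
  split_ifs with h
  · rw [mul_one, div_self (by linarith), Real.one_rpow]
  · rfl

lemma nbGen_le_one {r s z : ℝ} (hr : 0 ≤ r) (hz : z ≤ 1) : nbGen r s z ≤ 1 :=
  (nbGen_mono hr le_rfl hz).trans nbGen_one.le

@[fun_prop] lemma measurable_nbGen (r : ℝ) : Measurable fun p : ℝ × ℝ => nbGen r p.1 p.2 := by
  refine Measurable.ite ?_ (by fun_prop) measurable_const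
  exact (measurableSet_le measurable_const measurable_fst).inter
    (measurableSet_lt measurable_fst measurable_const)

lemma continuousOn_nbGen {r z : ℝ} (hr : 0 ≤ r) (hz : z ≤ 1) :
    ContinuousOn (fun s => nbGen r s z) (Ioo 0 1) := by
  have h1 : ContinuousOn (fun s => ((1 - s) / (1 - s * z)) ^ r) (Ioo 0 1) := by
    refine ContinuousOn.rpow_const (ContinuousOn.div (by fun_prop) (by fun_prop) ?_)
      fun s _ => Or.inr hr
    exact fun s hs => (one_sub_mul_pos hs.1.le hs.2 hz).ne'
  exact h1.congr fun s hs => nbGen_of_mem hs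

lemma lintegral_pow_negBin {r s z : ℝ} (hr : 0 < r) (hz0 : 0 ≤ z) (hz1 : z ≤ 1) :
    ∫⁻ x, ENNReal.ofReal z ^ x ∂(negBin r s) = ENNReal.ofReal (nbGen r s z) := by
  unfold negBin nbGen
  by_cases h : 0 ≤ s ∧ s < 1
  · rw [if_pos ⟨hr, h⟩, if_pos h]
    have h1 := one_sub_mul_pos h.1 h.2 hz1
    have h2 : HasSum (fun x => negBinProb r s x * z ^ x) (((1 - s) / (1 - s * z)) ^ r) := by
      have h3 := (hasSum_negBinProb (r := r) (mul_nonneg h.1 hz0)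
        (by linarith : s * z < 1)).mul_right (((1 - s) / (1 - s * z)) ^ r)
      rw [one_mul] at h3
      refine h3.congr_fun fun x => ?_
      unfold negBinProb
      rw [Real.div_rpow (by linarith) h1.le, mul_pow]
      have := (Real.rpow_pos_of_pos h1 r).ne'
      field_simp
    rw [lintegral_sum_measure]
    simp_rw [lintegral_smul_measure, lintegral_dirac]
    rw [← h2.tsum_eq, ENNReal.ofReal_tsum_of_nonneg _ h2.summable]
    · refine tsum_congr fun x => ?_
      rw [ENNReal.ofReal_mul (negBinProb_nonneg hr h.1 h.2 x), ENNReal.ofReal_pow hz0, smul_eq_mul]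
    · exact fun x => mul_nonneg (negBinProb_nonneg hr h.1 h.2 x) (pow_nonneg hz0 _)
  · rw [if_neg (by tauto), if_neg h]
    simp

lemma lintegral_infinitePi_prod {ι : Type*} {X : ι → Type*} [∀ i, MeasurableSpace (X i)]
    (μ : ∀ i, Measure (X i)) [∀ i, IsProbabilityMeasure (μ i)] (S : Finset ι)
    {f : ∀ i, X i → ℝ≥0∞} (hf : ∀ i, Measurable (f i)) :
    ∫⁻ a, ∏ i ∈ S, f i (a i) ∂(Measure.infinitePi μ) = ∏ i ∈ S, ∫⁻ x, f i x ∂(μ i) := by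
  have h1 := lintegral_prod_eq_prod_lintegral_of_indepFun S (fun i (a : ∀ i, X i) => f i (a i))
    (iIndepFun_infinitePi (P := μ) hf) (fun i => (hf i).comp (measurable_pi_apply i))
  refine h1.trans ?_
  refine Finset.prod_congr rfl fun i _ => ?_
  conv_rhs => rw [← Measure.infinitePi_map_eval μ i]
  rw [lintegral_map (hf i) (measurable_pi_apply i)]

/-- The factor of a unit with counts `a d`, `d < D`, in the joint generating function: the weight
is `y` if the unit is observed, and `z d` for each of its counts on day `d`. -/
def unitWeight (D : ℕ) (y : ℝ) (z : ℕ → ℝ) (a : ℕ → ℕ) : ℝ≥0∞ :=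
  (if ∀ d < D, a d = 0 then 1 else ENNReal.ofReal y) *
    ∏ d ∈ Finset.range D, ENNReal.ofReal (z d) ^ a d

/-- The expectation of `unitWeight` for a unit with rate `s`. -/
def unitGen (r : ℝ) (D : ℕ) (y s : ℝ) (z : ℕ → ℝ) : ℝ≥0∞ :=
  ENNReal.ofReal y * ∏ d ∈ Finset.range D, ENNReal.ofReal (nbGen r s (z d)) +
    ENNReal.ofReal (1 - y) * ∏ _d ∈ Finset.range D, ENNReal.ofReal (nbGen r s 0)

/-- The weight is a mixture of two products of powers, with bases `z` and `0`. As
`0 ^ 0 = 1`, the second product is the indicator that the unit is not observed. -/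
lemma unitWeight_eq {D : ℕ} {y : ℝ} (hy0 : 0 ≤ y) (hy1 : y ≤ 1) (z : ℕ → ℝ) (a : ℕ → ℕ) :
    unitWeight D y z a =
      ENNReal.ofReal y * ∏ d ∈ Finset.range D, ENNReal.ofReal (z d) ^ a d +
        ENNReal.ofReal (1 - y) * ∏ d ∈ Finset.range D, ENNReal.ofReal 0 ^ a d := by
  unfold unitWeight
  split_ifs with h
  · have h1 : ∀ x : ℕ → ℝ, ∏ d ∈ Finset.range D, ENNReal.ofReal (x d) ^ a d = 1 := fun x =>
      Finset.prod_eq_one fun d hd => by rw [h d (Finset.mem_range.1 hd), pow_zero]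
    rw [h1, h1 fun _ => 0, mul_one, mul_one, mul_one,
      ← ENNReal.ofReal_add hy0 (by linarith)]
    simp
  · push Not at h
    obtain ⟨d, hd, had⟩ := h
    rw [Finset.prod_eq_zero (i := d) (f := fun d => ENNReal.ofReal 0 ^ a d)
      (Finset.mem_range.2 hd) (by simp [had]), mul_zero, add_zero]

lemma lintegral_prod_pow_negBin {r : ℝ} (hr : 0 < r) (θ : ℕ → ℝ) (D K : ℕ) (C : ℕ → ℝ≥0∞)
    {z : ℕ → ℕ → ℝ} (hz0 : ∀ d n, 0 ≤ z d n) (hz1 : ∀ d n, z d n ≤ 1) :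
    ∫⁻ a, ∏ n ∈ Finset.range K, (C n * ∏ d ∈ Finset.range D, ENNReal.ofReal (z d n) ^ a (d, n))
        ∂(Measure.infinitePi fun i : ℕ × ℕ => negBin r (θ i.2)) =
      ∏ n ∈ Finset.range K, (C n * ∏ d ∈ Finset.range D, ENNReal.ofReal (nbGen r (θ n) (z d n))) := by
  simp_rw [Finset.prod_mul_distrib]
  have h1 := lintegral_infinitePi_prod (fun i : ℕ × ℕ => negBin r (θ i.2))
    (Finset.range D ×ˢ Finset.range K) (f := fun i x => ENNReal.ofReal (z i.1 i.2) ^ x)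
    (fun i => by fun_prop)
  simp_rw [lintegral_pow_negBin hr (hz0 _ _) (hz1 _ _), Finset.prod_product_right] at h1
  rw [lintegral_const_mul, h1]
  refine Finset.measurable_prod _ fun n _ => Finset.measurable_prod _ fun d _ => ?_
  exact (measurable_of_countable fun x : ℕ => ENNReal.ofReal (z d n) ^ x).comp
    (measurable_pi_apply (d, n))

/-- Given the rates and the labels, the units contribute independent factors. -/
lemma lintegral_prod_unitWeight {r : ℝ} (hr : 0 < r) (θ : ℕ → ℝ) (D K : ℕ) {y : ℝ}
    (hy0 : 0 ≤ y) (hy1 : y ≤ 1) {z : ℕ → ℕ → ℝ} (hz0 : ∀ d n, 0 ≤ z d n) (hz1 : ∀ d n, z d n ≤ 1) :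
    ∫⁻ a, ∏ n ∈ Finset.range K, unitWeight D y (fun d => z d n) (fun d => a (d, n))
        ∂(Measure.infinitePi fun i : ℕ × ℕ => negBin r (θ i.2)) =
      ∏ n ∈ Finset.range K, unitGen r D y (θ n) (fun d => z d n) := by
  have hterm : ∀ (t : Finset ℕ), t ⊆ Finset.range K → ∀ (f g : ℕ → ℝ≥0∞),
      (∏ n ∈ t, f n) * ∏ n ∈ Finset.range K \ t, g n =
        ∏ n ∈ Finset.range K, if n ∈ t then f n else g n := by
    intro t ht f g
    have := Finset.prod_piecewise (Finset.range K) t f g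
    rw [Finset.inter_eq_right.2 ht] at this
    rw [← this]
    rfl
  have hite : ∀ (p : Prop) [Decidable p] (C C' : ℝ≥0∞) (u v : ℕ → ℝ) (b : ℕ → ℝ → ℝ≥0∞),
      (if p then C * ∏ d ∈ Finset.range D, b d (u d) else C' * ∏ d ∈ Finset.range D, b d (v d)) =
        (if p then C else C') * ∏ d ∈ Finset.range D, b d (if p then u d else v d) := by
    intro p _ C C' u v b
    split_ifs <;> rfl
  -- both sides expand into sums over the set `t` of units for which the first term is chosen
  simp_rw [unitWeight_eq hy0 hy1, unitGen, Finset.prod_add]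
  rw [lintegral_finsetSum]
  · refine Finset.sum_congr rfl fun t ht => ?_
    rw [Finset.mem_powerset] at ht
    simp_rw [hterm t ht]
    have h1 := lintegral_prod_pow_negBin hr θ D K
      (fun n => if n ∈ t then ENNReal.ofReal y else ENNReal.ofReal (1 - y))
      (z := fun d n => if n ∈ t then z d n else 0)
      (fun d n => by split_ifs; exacts [hz0 d n, le_rfl])
      (fun d n => by split_ifs; exacts [hz1 d n, zero_le_one])
    refine Eq.trans (lintegral_congr fun a => Finset.prod_congr rfl fun n _ => ?_)
      (h1.trans (Finset.prod_congr rfl fun n _ => ?_))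
    · exact hite (n ∈ t) _ _ (fun d => z d n) (fun _ => 0) fun d x => ENNReal.ofReal x ^ a (d, n)
    · exact (hite (n ∈ t) _ _ (fun d => z d n) (fun _ => 0)
        fun _ x => ENNReal.ofReal (nbGen r (θ n) x)).symm
  · intro t _
    have hm : ∀ (u : ℕ → ℝ) (n : ℕ), Measurable fun a : ℕ × ℕ → ℕ =>
        ∏ d ∈ Finset.range D, ENNReal.ofReal (u d) ^ a (d, n) := fun u n =>
      Finset.measurable_prod _ fun d _ =>
        (measurable_of_countable fun x : ℕ => ENNReal.ofReal (u d) ^ x).comp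
          (measurable_pi_apply (d, n))
    exact (Finset.measurable_prod _ fun n _ => (hm _ n).const_mul _).mul
      (Finset.measurable_prod _ fun n _ => (hm (fun _ => 0) n).const_mul _)

/-! ### The mean generating function of a unit of a given rate -/

section Mean

variable {E : Type*} [MeasurableSpace E]

/-- The generating function of the counts of a unit of rate `s`, when the count of day `d` gets
the weight `ζ d x` depending on the label `x`, averaged over the law of the label. -/
def meanGen (P₀ : Measure E) (r : ℝ) (D : ℕ) (ζ : ℕ → E → ℝ) (s : ℝ) : ℝ≥0∞ :=
  ∫⁻ x, ∏ d ∈ Finset.range D, ENNReal.ofReal (nbGen r s (ζ d x)) ∂P₀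

/-- The probability that a unit of rate `s` is not observed on any of `D` days. -/
def unseenProb (r : ℝ) (D : ℕ) (s : ℝ) : ℝ≥0∞ :=
  ∏ _d ∈ Finset.range D, ENNReal.ofReal (nbGen r s 0)

/-- The mass of the observed units under the stable Lévy measure on the rates in `(0, 1)`, where
each unit is weighted by `ζ`. The difference in the integrand is the generating function restricted
to the event that the unit is observed. -/
def seenMass (σ : ℝ) (P₀ : Measure E) (r : ℝ) (D : ℕ) (ζ : ℕ → E → ℝ) : ℝ≥0∞ :=
  ∫⁻ s in Iio 1, (meanGen P₀ r D ζ s - unseenProb r D s) ∂(stableLevy σ)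

variable {P₀ : Measure E} [IsProbabilityMeasure P₀] {r : ℝ} {D : ℕ} {ζ : ℕ → E → ℝ}

lemma measurable_prod_nbGen (hζ : ∀ d, Measurable (ζ d)) :
    Measurable fun p : ℝ × E => ∏ d ∈ Finset.range D, ENNReal.ofReal (nbGen r p.1 (ζ d p.2)) :=
  Finset.measurable_prod _ fun d _ => ((measurable_nbGen r).comp
    (measurable_fst.prodMk ((hζ d).comp measurable_snd))).ennreal_ofReal

lemma measurable_meanGen (hζ : ∀ d, Measurable (ζ d)) : Measurable (meanGen P₀ r D ζ) :=
  (measurable_prod_nbGen hζ).lintegral_prod_right'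

@[fun_prop] lemma measurable_unseenProb : Measurable (unseenProb r D) :=
  Finset.measurable_prod _ fun _ _ => ((measurable_nbGen r).comp
    (measurable_id.prodMk measurable_const)).ennreal_ofReal

lemma prod_nbGen_le_one (hr : 0 ≤ r) {z : ℕ → ℝ} (hz : ∀ d, z d ≤ 1) (s : ℝ) :
    ∏ d ∈ Finset.range D, ENNReal.ofReal (nbGen r s (z d)) ≤ 1 :=
  Finset.prod_le_one' fun d _ => ENNReal.ofReal_le_one.2 (nbGen_le_one hr (hz d))

lemma meanGen_le_one (hr : 0 ≤ r) (hζ1 : ∀ d x, ζ d x ≤ 1) (s : ℝ) : meanGen P₀ r D ζ s ≤ 1 := by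
  refine (lintegral_mono fun x => prod_nbGen_le_one hr (fun d => hζ1 d x) s).trans ?_
  simp

lemma unseenProb_le_meanGen (hr : 0 ≤ r) (hζ0 : ∀ d x, 0 ≤ ζ d x) (hζ1 : ∀ d x, ζ d x ≤ 1)
    (s : ℝ) : unseenProb r D s ≤ meanGen P₀ r D ζ s := by
  have h1 : unseenProb r D s = ∫⁻ _, unseenProb r D s ∂P₀ := by simp
  rw [h1]
  exact lintegral_mono fun x => Finset.prod_le_prod' fun d _ =>
    ENNReal.ofReal_le_ofReal (nbGen_mono hr (hζ1 d x) (hζ0 d x))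

lemma unseenProb_of_mem {s : ℝ} (hs : s ∈ Ioo (0 : ℝ) 1) :
    unseenProb r D s = ENNReal.ofReal ((1 - s) ^ (r * D)) := by
  have h1 : 0 ≤ 1 - s := by linarith [hs.2]
  rw [unseenProb, Finset.prod_const, Finset.card_range, nbGen_of_mem hs, mul_zero, sub_zero, div_one,
    ← ENNReal.ofReal_pow (Real.rpow_nonneg h1 _), ← Real.rpow_natCast, ← Real.rpow_mul h1]

lemma continuousOn_unseenProb (hr : 0 ≤ r) : ContinuousOn (unseenProb r D) (Ioo 0 1) := by
  intro s hs
  exact ENNReal.tendsto_finsetProd_of_ne_top _ (fun d _ =>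
    (ENNReal.continuous_ofReal.tendsto _).comp (continuousOn_nbGen hr zero_le_one s hs))
    (fun d _ => ENNReal.ofReal_ne_top)

lemma continuousOn_meanGen (hr : 0 ≤ r) (hζ : ∀ d, Measurable (ζ d)) (hζ1 : ∀ d x, ζ d x ≤ 1) :
    ContinuousOn (meanGen P₀ r D ζ) (Ioo 0 1) := by
  intro s hs
  refine tendsto_lintegral_filter_of_dominated_convergence (fun _ => 1)
    (Eventually.of_forall fun s => ?_)
    (Eventually.of_forall fun s => ae_of_all _ fun x => prod_nbGen_le_one hr (fun d => hζ1 d x) s)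
    (by simp) (ae_of_all _ fun x => ?_)
  · exact (measurable_prod_nbGen hζ).comp measurable_prodMk_left
  · exact ENNReal.tendsto_finsetProd_of_ne_top _ (fun d _ =>
      (ENNReal.continuous_ofReal.tendsto _).comp (continuousOn_nbGen hr (hζ1 d x) s hs))
      (fun d _ => ENNReal.ofReal_ne_top)

lemma lintegral_unitGen (hζ : ∀ d, Measurable (ζ d)) (y s : ℝ) :
    ∫⁻ x, unitGen r D y s (fun d => ζ d x) ∂P₀ =
      ENNReal.ofReal y * meanGen P₀ r D ζ s + ENNReal.ofReal (1 - y) * unseenProb r D s := by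
  unfold unitGen
  have hm : Measurable fun x => ∏ d ∈ Finset.range D, ENNReal.ofReal (nbGen r s (ζ d x)) :=
    (measurable_prod_nbGen hζ).comp measurable_prodMk_left
  rw [lintegral_add_left (by fun_prop), lintegral_const_mul _ hm, lintegral_const, measure_univ,
    mul_one]
  rfl

/-- The total mass of the observed units is `ψ`. -/
lemma lintegral_one_sub_unseenProb {σ : ℝ} (hσ : σ ∈ Ioo (0 : ℝ) 1) (hr : 0 ≤ r) :
    ∫⁻ s in Iio 1, (1 - unseenProb r D s) ∂(stableLevy σ) = ENNReal.ofReal (psi σ r 0 D) := by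
  rw [← (lintegral_one_sub_rpow hσ (mul_nonneg hr (Nat.cast_nonneg D))).2]
  refine lintegral_congr_ae ?_
  filter_upwards [ae_restrict_of_ae (ae_stableLevy_pos σ), ae_restrict_mem measurableSet_Iio]
    with s hs hs1
  rw [unseenProb_of_mem ⟨hs, hs1⟩]

/-- The exponent `∫ (1 - φ) dν` of the Laplace functional, for the mean weight `φ` of a unit, is
`ψ - y ρ` with `ρ = seenMass`. It is stated as a sum to avoid truncated subtraction. -/
lemma lintegral_one_sub_mix {σ : ℝ} (hσ : σ ∈ Ioo (0 : ℝ) 1) (hr : 0 ≤ r)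
    (hζ : ∀ d, Measurable (ζ d)) (hζ0 : ∀ d x, 0 ≤ ζ d x)
    (hζ1 : ∀ d x, ζ d x ≤ 1) {y : ℝ} (hy0 : 0 ≤ y) (hy1 : y ≤ 1) :
    ∫⁻ s in Iio 1, (1 - (ENNReal.ofReal y * meanGen P₀ r D ζ s +
        ENNReal.ofReal (1 - y) * unseenProb r D s)) ∂(stableLevy σ) +
      ENNReal.ofReal y * seenMass σ P₀ r D ζ = ENNReal.ofReal (psi σ r 0 D) := by
  have hm := measurable_meanGen (P₀ := P₀) (r := r) (D := D) hζ
  rw [← lintegral_one_sub_unseenProb hσ hr, seenMass, ← lintegral_const_mul _ (by fun_prop),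
    ← lintegral_add_left (by fun_prop)]
  refine lintegral_congr fun s => ?_
  have h1 := meanGen_le_one (P₀ := P₀) (D := D) hr hζ1 s
  have h2 := unseenProb_le_meanGen (P₀ := P₀) (D := D) hr hζ0 hζ1 s
  obtain ⟨p, hp⟩ : ∃ p : NNReal, meanGen P₀ r D ζ s = p :=
    ⟨_, (ENNReal.coe_toNNReal (h1.trans_lt ENNReal.one_lt_top).ne).symm⟩
  obtain ⟨q, hq⟩ : ∃ q : NNReal, unseenProb r D s = q :=
    ⟨_, (ENNReal.coe_toNNReal ((h2.trans h1).trans_lt ENNReal.one_lt_top).ne).symm⟩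
  rw [hp] at h1 h2
  rw [hq] at h2
  rw [hp, hq]
  have h1' : (p : ℝ) ≤ 1 := by exact_mod_cast h1
  have h2' : (q : ℝ) ≤ p := by exact_mod_cast h2
  have hq0 : (0 : ℝ) ≤ q := q.2
  have hyp : 0 ≤ y * (p : ℝ) := mul_nonneg hy0 p.2
  have hyq : 0 ≤ (1 - y) * (q : ℝ) := mul_nonneg (by linarith) hq0
  rw [← ENNReal.ofReal_coe_nnreal, ← ENNReal.ofReal_coe_nnreal,
    ← ENNReal.ofReal_mul hy0, ← ENNReal.ofReal_mul (by linarith), ← ENNReal.ofReal_add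
      hyp hyq, one_sub_ofReal (add_nonneg hyp hyq), ← ENNReal.ofReal_sub _ hq0,
    ← ENNReal.ofReal_mul hy0, one_sub_ofReal hq0, ← ENNReal.ofReal_add]
  · congr 1
    ring
  · nlinarith [q.2, p.2]
  · exact mul_nonneg hy0 (by linarith)

end Mean

/-! ### The joint generating function of the model -/

section Model

variable {Ω₀ Ω E : Type*} [MeasurableSpace Ω₀] [MeasurableSpace Ω] [MeasurableSpace E]
  {σ β c r : ℝ} {Q : Measure Ω₀} [IsProbabilityMeasure Q] {Δ : ℕ → Ω₀ → ℝ}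
  {P₀ : Measure E} [IsProbabilityMeasure P₀] {P : Measure Ω} [IsProbabilityMeasure P]
  {T : Ω → ℝ} {θ : ℕ → Ω → ℝ} {w : ℕ → Ω → E} {A : ℕ → ℕ → Ω → ℕ}

/-- The counts are integrated out first, given the jump, the rates and the labels. -/
lemma IsModel.lintegral_counts {G : Kernel ℝ (ℕ → ℝ)} (h : IsModel σ β c r G P₀ P T θ w A)
    {F : (ℝ × (ℕ → ℝ) × (ℕ → E)) × (ℕ × ℕ → ℕ) → ℝ≥0∞} (hF : Measurable F) :
    ∫⁻ ω, F ((T ω, (fun n => θ n ω), fun n => w n ω), fun i => A i.1 i.2 ω) ∂P =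
      ∫⁻ ω, ∫⁻ a, F ((T ω, (fun n => θ n ω), fun n => w n ω), a)
        ∂(Measure.infinitePi fun i : ℕ × ℕ => negBin r (θ i.2 ω)) ∂P := by
  have hX : Measurable fun ω => (T ω, (fun n => θ n ω), fun n => w n ω) :=
    h.measurable_jump.prodMk ((measurable_pi_lambda _ h.measurable_rate).prodMk
      (measurable_pi_lambda _ h.measurable_label))
  have hA : Measurable fun ω (i : ℕ × ℕ) => A i.1 i.2 ω :=
    measurable_pi_lambda _ fun i => h.measurable_count i.1 i.2
  rw [← lintegral_map (f := F) (g := fun ω => ((T ω, (fun n => θ n ω), fun n => w n ω),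
    fun i : ℕ × ℕ => A i.1 i.2 ω)) hF (hX.prodMk hA),
    ← compProd_map_condDistrib hA.aemeasurable, Measure.lintegral_compProd hF,
    lintegral_map (Measurable.lintegral_kernel_prod_right' hF) hX]
  refine lintegral_congr_ae ?_
  filter_upwards [h.law_counts] with ω hω
  rw [hω]

lemma measurable_unitGen {D : ℕ} {ζ : ℕ → E → ℝ} (hζ : ∀ d, Measurable (ζ d)) (y : ℝ) :
    Measurable fun p : ℝ × E => unitGen r D y p.1 (fun d => ζ d p.2) := by
  unfold unitGen
  have h1 := measurable_prod_nbGen (r := r) (D := D) hζ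
  have h2 : Measurable fun p : ℝ × E => unseenProb r D p.1 := by fun_prop
  exact (h1.const_mul _).add (h2.const_mul _)

lemma measurable_unitWeight {D : ℕ} {ζ : ℕ → E → ℝ} (hζ : ∀ d, Measurable (ζ d)) (y : ℝ) :
    Measurable fun p : E × (ℕ → ℕ) => unitWeight D y (fun d => ζ d p.1) p.2 := by
  unfold unitWeight
  refine Measurable.mul ?_ (Finset.measurable_prod _ fun d _ => ?_)
  · refine Measurable.ite ?_ measurable_const measurable_const
    have : {p : E × (ℕ → ℕ) | ∀ d < D, p.2 d = 0} = ⋂ d, ⋂ _ : d < D, {p | p.2 d = 0} := by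
      ext; simp
    rw [this]
    exact MeasurableSet.iInter fun d => MeasurableSet.iInter fun _ =>
      (measurable_pi_apply d).comp measurable_snd (measurableSet_singleton 0)
  · have h1 : Measurable fun p : E × (ℕ → ℕ) => ENNReal.ofReal (ζ d p.1) :=
      ((hζ d).comp measurable_fst).ennreal_ofReal
    have h2 : Measurable fun p : E × (ℕ → ℕ) => p.2 d := (measurable_pi_apply d).comp measurable_snd
    exact h1.pow h2

lemma unitWeight_le_one {D : ℕ} {y : ℝ} (hy1 : y ≤ 1) {z : ℕ → ℝ} (hz1 : ∀ d, z d ≤ 1)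
    (a : ℕ → ℕ) : unitWeight D y z a ≤ 1 := by
  refine mul_le_one' ?_ (Finset.prod_le_one' fun d _ =>
    pow_le_one₀ zero_le (ENNReal.ofReal_le_one.2 (hz1 d)))
  split_ifs
  · exact le_rfl
  · exact ENNReal.ofReal_le_one.2 hy1

/-- Averaging the contributions of the first `K` units over the counts and the labels. -/
lemma IsModel.lintegral_prod_unitWeight {G : Kernel ℝ (ℕ → ℝ)}
    (h : IsModel σ β c r G P₀ P T θ w A) (hr : 0 < r) {D : ℕ} {ζ : ℕ → E → ℝ}
    (hζ : ∀ d, Measurable (ζ d)) (hζ0 : ∀ d x, 0 ≤ ζ d x) (hζ1 : ∀ d x, ζ d x ≤ 1) {y : ℝ}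
    (hy0 : 0 ≤ y) (hy1 : y ≤ 1) {g : ℝ → ℝ≥0∞} (hg : Measurable g) (K : ℕ) :
    ∫⁻ ω, g (T ω) * ∏ n ∈ Finset.range K,
        unitWeight D y (fun d => ζ d (w n ω)) (fun d => A d n ω) ∂P =
      ∫⁻ ω, g (T ω) * ∏ n ∈ Finset.range K, (ENNReal.ofReal y * meanGen P₀ r D ζ (θ n ω) +
        ENNReal.ofReal (1 - y) * unseenProb r D (θ n ω)) ∂P := by
  have hm1 : Measurable fun q : (ℝ × (ℕ → ℝ) × (ℕ → E)) × (ℕ × ℕ → ℕ) => g q.1.1 *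
      ∏ n ∈ Finset.range K, unitWeight D y (fun d => ζ d (q.1.2.2 n)) (fun d => q.2 (d, n)) := by
    refine Measurable.mul (by fun_prop) (Finset.measurable_prod _ fun n _ => ?_)
    have : Measurable fun q : (ℝ × (ℕ → ℝ) × (ℕ → E)) × (ℕ × ℕ → ℕ) =>
        (q.1.2.2 n, fun d => q.2 (d, n)) := by fun_prop
    exact (measurable_unitWeight hζ y).comp this
  have hm2 : Measurable fun q : (ℝ × (ℕ → ℝ)) × (ℕ → E) => g q.1.1 *
      ∏ n ∈ Finset.range K, unitGen r D y (q.1.2 n) (fun d => ζ d (q.2 n)) := by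
    refine Measurable.mul (by fun_prop) (Finset.measurable_prod _ fun n _ => ?_)
    have : Measurable fun q : (ℝ × (ℕ → ℝ)) × (ℕ → E) => (q.1.2 n, q.2 n) := by fun_prop
    have h3 := (measurable_unitGen (r := r) (D := D) hζ y).comp this
    exact h3
  have hTθ : Measurable fun ω => (T ω, fun n => θ n ω) :=
    h.measurable_jump.prodMk (measurable_pi_lambda _ h.measurable_rate)
  have hw : Measurable fun ω n => w n ω := measurable_pi_lambda _ h.measurable_label
  have e1 := h.lintegral_counts hm1
  have e2 : ∀ ω, ∫⁻ a, g (T ω) * ∏ n ∈ Finset.range K,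
        unitWeight D y (fun d => ζ d (w n ω)) (fun d => a (d, n))
        ∂(Measure.infinitePi fun i : ℕ × ℕ => negBin r (θ i.2 ω)) =
      g (T ω) * ∏ n ∈ Finset.range K, unitGen r D y (θ n ω) (fun d => ζ d (w n ω)) := by
    intro ω
    rw [lintegral_const_mul]
    · rw [SBSP.lintegral_prod_unitWeight hr (fun n => θ n ω) D K hy0 hy1
        (z := fun d n => ζ d (w n ω)) (fun d n => hζ0 _ _) (fun d n => hζ1 _ _)]
    · refine Finset.measurable_prod _ fun n _ => ?_
      have : Measurable fun a : ℕ × ℕ → ℕ => (w n ω, fun d => a (d, n)) := by fun_prop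
      exact (measurable_unitWeight hζ y).comp this
  refine e1.trans ?_
  simp only [e2]
  have e3 := lintegral_map hm2 (hTθ.prodMk hw) (μ := P)
  refine e3.symm.trans ?_
  rw [(indepFun_iff_map_prod_eq_prod_map_map hTθ.aemeasurable hw.aemeasurable).1 h.indep_labels,
    lintegral_prod _ hm2.aemeasurable, h.law_labels, lintegral_map
      (Measurable.lintegral_prod_right' hm2) hTθ]
  refine lintegral_congr fun ω => ?_
  simp only
  rw [lintegral_const_mul]
  · congr 1
    have hm3 : ∀ n : ℕ, Measurable fun x => unitGen r D y (θ n ω) fun d => ζ d x := fun n => by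
      have h3 := (measurable_unitGen (r := r) (D := D) hζ y).comp
        (measurable_prodMk_left (x := θ n ω))
      exact h3
    have h4 := lintegral_infinitePi_prod (X := fun _ : ℕ => E) (fun _ => P₀) (Finset.range K) hm3
    refine h4.trans ?_
    simp_rw [lintegral_unitGen hζ]
  · refine Finset.measurable_prod _ fun n _ => ?_
    have : Measurable fun q : ℕ → E => (θ n ω, q n) := by fun_prop
    have h3 := (measurable_unitGen (r := r) (D := D) hζ y).comp this
    exact h3

/-- Transfer of an expectation over the jump and the rates to the stable process. -/
lemma IsModel.lintegral_rates (hσ : σ ∈ Ioo (0 : ℝ) 1) (hΔ : IsStableJumps σ Q Δ)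
    (h : IsModel σ β c r (scaledJumpsKernel Q Δ) P₀ P T θ w A)
    {F : ℝ × (ℕ → ℝ) → ℝ≥0∞} (hF : Measurable F) :
    ∫⁻ ω, F (T ω, fun n => θ n ω) ∂P =
      ∫⁻ ω, ENNReal.ofReal (tilt σ β c (Δ 0 ω)) *
        F (Δ 0 ω, fun n => Δ (n + 1) ω / Δ 0 ω) ∂Q := by
  have hTθ : Measurable fun ω => (T ω, fun n => θ n ω) :=
    h.measurable_jump.prodMk (measurable_pi_lambda _ h.measurable_rate)
  have h0 := hΔ.measurable 0
  have hY : Measurable fun ω n => Δ (n + 1) ω / Δ 0 ω :=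
    measurable_pi_lambda _ fun n => by have := hΔ.measurable (n + 1); fun_prop
  have htm : Measurable (tilt σ β c) := by unfold tilt; fun_prop
  have htilt : tiltedJumpLaw σ β c =
      (Q.map (Δ 0)).withDensity fun s => ENNReal.ofReal (tilt σ β c s) := by
    rw [hΔ.map_largest hσ.1, ← withDensity_mul _ (measurable_largestJumpDensity σ).ennreal_ofReal
      htm.ennreal_ofReal, tiltedJumpLaw]
    congr 1
    ext s
    have hnn : 0 ≤ largestJumpDensity σ s := by
      unfold largestJumpDensity
      split_ifs
      · have := hσ.1
        positivity
      · exact le_rfl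
    rw [Pi.mul_apply, ENNReal.ofReal_mul' hnn, mul_comm]
  have : SFinite (tiltedJumpLaw σ β c) := by rw [htilt]; infer_instance
  have : IsMarkovKernel (scaledJumpsKernel Q Δ) := by unfold scaledJumpsKernel; infer_instance
  rw [← lintegral_map hF hTθ, h.law_rates, Measure.lintegral_compProd hF, htilt,
    lintegral_withDensity_eq_lintegral_mul _ htm.ennreal_ofReal hF.lintegral_kernel_prod_right']
  have e1 := compProd_map_condDistrib (mβ := inferInstance) (μ := Q) (X := Δ 0)
    (Y := fun ω n => Δ (n + 1) ω / Δ 0 ω) hY.aemeasurable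
  have hm : Measurable fun p : ℝ × (ℕ → ℝ) => ENNReal.ofReal (tilt σ β c p.1) * F p := by fun_prop
  rw [← lintegral_map (f := fun p : ℝ × (ℕ → ℝ) => ENNReal.ofReal (tilt σ β c p.1) * F p) hm
    (h0.prodMk hY), ← e1, Measure.lintegral_compProd hm]
  refine lintegral_congr fun t => ?_
  exact (lintegral_const_mul _ (hF.comp measurable_prodMk_left)).symm

/-- The Laplace transform of a gamma law, in terms of `expNeg`. -/
lemma lintegral_expNeg_gammaMeasure {a b l : ℝ} (ha : 0 < a) (hb : 0 < b) (hl : 0 ≤ l) :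
    ∫⁻ v, expNeg (ENNReal.ofReal l * ENNReal.ofReal v) ∂(gammaMeasure a b) =
      ENNReal.ofReal ((b / (b + l)) ^ a) := by
  rw [← lintegral_exp_gammaMeasure ha hb hl]
  refine lintegral_congr_ae ?_
  filter_upwards [ae_gammaMeasure_pos a b] with v hv
  rw [← ENNReal.ofReal_mul hl, expNeg_ofReal (mul_nonneg hl hv.le)]

lemma IsModel.map_jump (h : IsModel σ β c r (scaledJumpsKernel Q Δ) P₀ P T θ w A) (hσ : 0 < σ) :
    P.map T = (gammaMeasure (c + 1) β).map fun v => v ^ (-1 / σ) := by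
  have hTθ : Measurable fun ω => (T ω, fun n => θ n ω) :=
    h.measurable_jump.prodMk (measurable_pi_lambda _ h.measurable_rate)
  have : IsMarkovKernel (scaledJumpsKernel Q Δ) := by unfold scaledJumpsKernel; infer_instance
  have : SFinite (tiltedJumpLaw σ β c) := by
    unfold tiltedJumpLaw
    infer_instance
  have h1 := congrArg Measure.fst h.law_rates
  rw [Measure.fst_compProd, Measure.fst, Measure.map_map measurable_fst hTθ] at h1
  rw [← tiltedJumpLaw_eq hσ, ← h1]
  rfl

lemma IsModel.ae_jump_pos (h : IsModel σ β c r (scaledJumpsKernel Q Δ) P₀ P T θ w A)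
    (hσ : 0 < σ) : ∀ᵐ ω ∂P, 0 < T ω := by
  have h1 : ∀ᵐ t ∂(P.map T), 0 < t := by
    rw [h.map_jump hσ]
    refine (ae_map_iff (by fun_prop) measurableSet_Ioi).2 ?_
    filter_upwards [ae_gammaMeasure_pos (c + 1) β] with v hv using Real.rpow_pos_of_pos hv _
  exact ae_of_ae_map h.measurable_jump.aemeasurable h1

lemma IsModel.lintegral_expNeg_jump (h : IsModel σ β c r (scaledJumpsKernel Q Δ) P₀ P T θ w A)
    (hσ : 0 < σ) (hβ : 0 < β) (hc : 0 < c) {l : ℝ} (hl : 0 ≤ l) :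
    ∫⁻ ω, expNeg (ENNReal.ofReal l * ENNReal.ofReal (T ω ^ (-σ))) ∂P =
      ENNReal.ofReal ((β / (β + l)) ^ (c + 1)) := by
  have hm : Measurable fun t : ℝ => expNeg (ENNReal.ofReal l * ENNReal.ofReal (t ^ (-σ))) := by
    fun_prop
  rw [← lintegral_map hm h.measurable_jump, h.map_jump hσ, lintegral_map hm (by fun_prop),
    ← lintegral_expNeg_gammaMeasure (by linarith) hβ hl]
  refine lintegral_congr_ae ?_
  filter_upwards [ae_gammaMeasure_pos (c + 1) β] with v hv
  rw [← Real.rpow_mul hv.le, show -1 / σ * -σ = 1 by field_simp, Real.rpow_one]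

lemma seenMass_le (hσ : σ ∈ Ioo (0 : ℝ) 1) (hr : 0 ≤ r) {D : ℕ} {ζ : ℕ → E → ℝ}
    (hζ : ∀ d, Measurable (ζ d)) (hζ0 : ∀ d x, 0 ≤ ζ d x) (hζ1 : ∀ d x, ζ d x ≤ 1) :
    seenMass σ P₀ r D ζ ≤ ENNReal.ofReal (psi σ r 0 D) := by
  have h1 := lintegral_one_sub_mix (P₀ := P₀) (D := D) hσ hr hζ hζ0 hζ1 zero_le_one le_rfl
  rw [← h1, ENNReal.ofReal_one, one_mul]
  exact le_add_self

/-- The joint generating function of the jump and of the counts. The infinite product runs over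
the units; `y` counts the observed ones. By conditioning, the product turns into the factor
`exp (-(ψ - y ρ) T ^ (-σ))`, and the gamma law of `T ^ (-σ)` is used last. -/
theorem IsModel.lintegral_unitWeight (hσ : σ ∈ Ioo (0 : ℝ) 1) (hβ : 0 < β) (hc : 0 < c)
    (hr : 0 < r) (hΔ : IsStableJumps σ Q Δ)
    (h : IsModel σ β c r (scaledJumpsKernel Q Δ) P₀ P T θ w A) {D : ℕ} {ζ : ℕ → E → ℝ}
    (hζ : ∀ d, Measurable (ζ d)) (hζ0 : ∀ d x, 0 ≤ ζ d x) (hζ1 : ∀ d x, ζ d x ≤ 1) {y l : ℝ}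
    (hy0 : 0 ≤ y) (hy1 : y ≤ 1) (hl : 0 ≤ l) :
    ∫⁻ ω, expNeg (ENNReal.ofReal l * ENNReal.ofReal (T ω ^ (-σ))) * ⨅ K, ∏ n ∈ Finset.range K,
        unitWeight D y (fun d => ζ d (w n ω)) (fun d => A d n ω) ∂P =
      ENNReal.ofReal ((β / (β + (l + (psi σ r 0 D - y * (seenMass σ P₀ r D ζ).toReal)))) ^
        (c + 1)) := by
  set g : ℝ → ℝ≥0∞ := fun t => expNeg (ENNReal.ofReal l * ENNReal.ofReal (t ^ (-σ))) with hgdef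
  have hg : Measurable g := by fun_prop
  have hg1 : ∀ t, g t ≤ 1 := fun t => expNeg_le_one _
  have hT := h.measurable_jump
  set φ : ℝ → ℝ≥0∞ := fun s => ENNReal.ofReal y * meanGen P₀ r D ζ s +
    ENNReal.ofReal (1 - y) * unseenProb r D s with hφdef
  have hmg := measurable_meanGen (P₀ := P₀) (r := r) (D := D) hζ
  have hφ : Measurable φ := by fun_prop
  have hφ1 : ∀ s, φ s ≤ 1 := by
    intro s
    have h1 := meanGen_le_one (P₀ := P₀) (D := D) hr.le hζ1 s
    have h2 := (unseenProb_le_meanGen (P₀ := P₀) (D := D) hr.le hζ0 hζ1 s).trans h1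
    calc φ s ≤ ENNReal.ofReal y * 1 + ENNReal.ofReal (1 - y) * 1 := by
          simp only [hφdef]
          gcongr
      _ = 1 := by
          rw [mul_one, mul_one, ← ENNReal.ofReal_add hy0 (by linarith)]
          simp
  have hφc : ContinuousOn φ (Ioo 0 1) := by
    intro s hs
    exact (ENNReal.Tendsto.const_mul (continuousOn_meanGen hr.le hζ hζ1 s hs)
      (Or.inr ENNReal.ofReal_ne_top)).add (ENNReal.Tendsto.const_mul
        (continuousOn_unseenProb hr.le s hs) (Or.inr ENNReal.ofReal_ne_top))
  have hψ := (lintegral_one_sub_rpow hσ (mul_nonneg hr.le (Nat.cast_nonneg D))).1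
  set I := ∫⁻ s in Iio 1, (1 - φ s) ∂(stableLevy σ) with hIdef
  set ρ := (seenMass σ P₀ r D ζ).toReal with hρdef
  have hseen := seenMass_le (P₀ := P₀) (D := D) hσ hr.le hζ hζ0 hζ1
  have hρ : seenMass σ P₀ r D ζ = ENNReal.ofReal ρ :=
    (ENNReal.ofReal_toReal (hseen.trans_lt ENNReal.ofReal_lt_top).ne).symm
  have hρ0 : 0 ≤ ρ := ENNReal.toReal_nonneg
  have hρψ : ρ ≤ psi σ r 0 D := by
    rw [hρ] at hseen
    exact (ENNReal.ofReal_le_ofReal_iff hψ).1 hseen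
  have hI : I = ENNReal.ofReal (psi σ r 0 D - y * ρ) := by
    have h1 := lintegral_one_sub_mix (P₀ := P₀) (D := D) hσ hr.le hζ hζ0 hζ1 hy0 hy1
    rw [hρ, ← ENNReal.ofReal_mul hy0] at h1
    rw [ENNReal.ofReal_sub _ (mul_nonneg hy0 hρ0), ← h1]
    exact (ENNReal.add_sub_cancel_right ENNReal.ofReal_ne_top).symm
  have hI0 : 0 ≤ psi σ r 0 D - y * ρ := by nlinarith
  have hinf : ∀ (a : ℕ → Ω → ℝ≥0∞), (∀ n, Measurable (a n)) → (∀ n ω, a n ω ≤ 1) →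
      ∫⁻ ω, g (T ω) * ⨅ K, ∏ n ∈ Finset.range K, a n ω ∂P =
        ⨅ K, ∫⁻ ω, g (T ω) * ∏ n ∈ Finset.range K, a n ω ∂P := by
    intro a ha ha1
    rw [← lintegral_iInf]
    · refine lintegral_congr fun ω => ENNReal.mul_iInf ?_
      exact fun h => absurd h ((hg1 _).trans_lt ENNReal.one_lt_top).ne
    · exact fun K => (hg.comp hT).mul (Finset.measurable_prod _ fun n _ => ha n)
    · exact fun i j hij ω => mul_le_mul_right (antitone_prod_range (fun n => ha1 n ω) hij) _
    · refine ((lintegral_mono fun ω => (?_ : _ ≤ (1 : ℝ≥0∞))).trans_lt ?_).ne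
      · simpa using hg1 (T ω)
      · simp
  have hw1 : ∀ n, Measurable fun ω =>
      unitWeight D y (fun d => ζ d (w n ω)) (fun d => A d n ω) := by
    intro n
    have : Measurable fun ω => (w n ω, fun d => A d n ω) :=
      (h.measurable_label n).prodMk (measurable_pi_lambda _ fun d => h.measurable_count d n)
    have h3 := (measurable_unitWeight (D := D) hζ y).comp this
    exact h3
  rw [hinf _ hw1 fun n ω => unitWeight_le_one hy1 (fun d => hζ1 _ _) _]
  simp_rw [h.lintegral_prod_unitWeight hr hζ hζ0 hζ1 hy0 hy1 hg]
  rw [← hinf (fun n ω => φ (θ n ω)) (fun n => hφ.comp (h.measurable_rate n)) fun n ω => hφ1 _]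
  have hF : Measurable fun p : ℝ × (ℕ → ℝ) => g p.1 * ⨅ K, ∏ n ∈ Finset.range K, φ (p.2 n) := by
    refine (hg.comp measurable_fst).mul (Measurable.iInf fun K => Finset.measurable_prod _
      fun n _ => ?_)
    fun_prop
  have htm : Measurable (tilt σ β c) := by unfold tilt; fun_prop
  rw [h.lintegral_rates hσ hΔ hF]
  simp_rw [← mul_assoc]
  have hIne : ∫⁻ s in Iio 1, (1 - φ s) ∂(stableLevy σ) ≠ ∞ := by
    rw [← hIdef, hI]
    exact ENNReal.ofReal_ne_top
  rw [hΔ.lintegral_ratio hσ.1 hφ hφ1 hφc hIne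
    (u := fun t => ENNReal.ofReal (tilt σ β c t) * g t) (by fun_prop)]
  simp_rw [mul_assoc]
  rw [← h.lintegral_rates hσ hΔ (F := fun p => g p.1 * expNeg (ENNReal.ofReal (p.1 ^ (-σ)) * I))
    (by fun_prop), ← h.lintegral_expNeg_jump hσ.1 hβ hc (add_nonneg hl hI0)]
  refine lintegral_congr fun ω => ?_
  rw [hgdef, ← expNeg_add, hI, ENNReal.ofReal_add hl hI0, add_mul]
  congr 2
  exact mul_comm _ _

end Model

/-! ### Laplace transforms determine measures -/

lemma continuous_toReal_expNeg : Continuous fun x => (expNeg x).toReal :=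
  ENNReal.continuousOn_toReal.comp_continuous continuous_expNeg
    fun x => ((expNeg_le_one x).trans_lt ENNReal.one_lt_top).ne

lemma toReal_expNeg_injective : Function.Injective fun x => (expNeg x).toReal := by
  intro x y h
  exact expNeg_strictAnti.injective ((ENNReal.toReal_eq_toReal_iff'
    ((expNeg_le_one x).trans_lt ENNReal.one_lt_top).ne
    ((expNeg_le_one y).trans_lt ENNReal.one_lt_top).ne).1 h)

/-- The functions `exp (-x i)` generate a separating algebra of continuous functions on the compact
space `[0, ∞] ^ κ`, so that the Laplace transform at integer arguments determines a measure. -/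
lemma ext_of_lintegral_expNeg_pi {κ : Type*} [Fintype κ] {μ ν : Measure (κ → ℝ≥0∞)}
    [IsFiniteMeasure μ] [IsFiniteMeasure ν]
    (h : ∀ k : κ → ℕ, ∫⁻ x, ∏ i, expNeg (x i) ^ k i ∂μ = ∫⁻ x, ∏ i, expNeg (x i) ^ k i ∂ν) :
    μ = ν := by
  set e : κ → BoundedContinuousFunction (κ → ℝ≥0∞) ℝ := fun i =>
    BoundedContinuousFunction.mkOfCompact
      ⟨fun x => (expNeg (x i)).toReal, continuous_toReal_expNeg.comp (continuous_apply i)⟩ with he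
  have hei : ∀ i x, e i x = (expNeg (x i)).toReal := fun i x => rfl
  set A := StarAlgebra.adjoin ℝ (Set.range e)
  refine ext_of_forall_mem_subalgebra_integral_eq_of_polish (𝕜 := ℝ) (A := A) ?_ ?_
  · intro x y hxy
    obtain ⟨i, hi⟩ := Function.ne_iff.1 hxy
    refine ⟨fun x => (expNeg (x i)).toReal, ?_, fun h' => hi (toReal_expNeg_injective h')⟩
    refine ⟨(e i).toContinuousMapStarₐ ℝ, ?_, rfl⟩
    exact ⟨e i, StarAlgebra.subset_adjoin _ _ ⟨i, rfl⟩, rfl⟩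
  · intro g hg
    have h1 : g ∈ Submodule.span ℝ
        (Submonoid.closure (Set.range e ∪ star (Set.range e)) : Set _) := by
      rw [← StarAlgebra.adjoin_eq_span]
      exact hg
    have hmono : ∀ g ∈ Submonoid.closure (Set.range e ∪ star (Set.range e)),
        ∃ k : κ → ℕ, g = ∏ i, e i ^ k i := by
      classical
      have hstar : star (Set.range e) = Set.range e := by
        ext f
        rw [Set.mem_star]
        have : star f = f := by ext x; simp
        rw [this]
      rw [hstar, Set.union_self]
      intro g hg
      induction hg using Submonoid.closure_induction with
      | mem g hg =>
        obtain ⟨i, rfl⟩ := hg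
        exact ⟨Pi.single i 1, by
          rw [Finset.prod_eq_single i (fun j _ hj => by simp [hj]) (by simp)]
          simp⟩
      | one => exact ⟨0, by simp⟩
      | mul f g _ _ hf hg =>
        obtain ⟨k, rfl⟩ := hf
        obtain ⟨m, rfl⟩ := hg
        exact ⟨k + m, by simp [pow_add, Finset.prod_mul_distrib]⟩
    clear hg
    induction h1 using Submodule.span_induction with
    | mem g hg =>
      obtain ⟨k, rfl⟩ := hmono g hg
      have h2 : ∀ x, (∏ i, e i ^ k i : BoundedContinuousFunction (κ → ℝ≥0∞) ℝ) x =
          (∏ i, expNeg (x i) ^ k i).toReal := by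
        intro x
        rw [ENNReal.toReal_prod]
        simp [hei]
      simp_rw [h2]
      rw [integral_toReal, integral_toReal, h k]
      all_goals first
        | exact Measurable.aemeasurable (by fun_prop)
        | exact ae_of_all _ fun x => ENNReal.prod_lt_top fun i _ =>
            ENNReal.pow_lt_top ((expNeg_le_one _).trans_lt ENNReal.one_lt_top)
    | zero => simp
    | add f g _ _ hf hg =>
      simp only [BoundedContinuousFunction.coe_add, Pi.add_apply]
      rw [integral_add (f.integrable μ) (g.integrable μ),
        integral_add (f.integrable ν) (g.integrable ν), hf, hg]
    | smul a f _ hf =>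
      simp only [BoundedContinuousFunction.coe_smul]
      rw [integral_smul, integral_smul, hf]

/-- A finite measure on a space whose `σ`-algebra is generated by functions `h i` with values in
`[0, ∞]` is determined by the joint Laplace transforms of the `h i`. -/
lemma ext_of_lintegral_expNeg {ι Y : Type*} [mY : MeasurableSpace Y] {h : ι → Y → ℝ≥0∞}
    (hY : mY = ⨆ i, MeasurableSpace.comap (h i) inferInstance) {μ ν : Measure Y}
    [IsFiniteMeasure μ] [IsFiniteMeasure ν]
    (H : ∀ (S : Finset ι) (k : ι → ℕ), ∫⁻ y, ∏ i ∈ S, expNeg (h i y) ^ k i ∂μ =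
      ∫⁻ y, ∏ i ∈ S, expNeg (h i y) ^ k i ∂ν) : μ = ν := by
  classical
  have hm : ∀ i, Measurable (h i) := fun i => by
    rw [measurable_iff_comap_le]
    conv_rhs => rw [hY]
    exact le_iSup (fun i => MeasurableSpace.comap (h i) inferInstance) i
  have hG : Measurable fun y i => h i y := measurable_pi_lambda _ hm
  have hmap : μ.map (fun y i => h i y) = ν.map (fun y i => h i y) := by
    refine IsProjectiveLimit.unique
      (P := fun S : Finset ι => (μ.map (fun y i => h i y)).map S.restrict) (fun S => rfl)
      fun S => ?_
    refine (ext_of_lintegral_expNeg_pi fun k => ?_).symm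
    have hk := H S fun i => if hi : i ∈ S then k ⟨i, hi⟩ else 0
    have hprod : ∀ y, ∏ i ∈ S, expNeg (h i y) ^ (if hi : i ∈ S then k ⟨i, hi⟩ else 0) =
        ∏ i : S, expNeg (S.restrict (fun i => h i y) i) ^ k i := by
      intro y
      rw [← Finset.prod_coe_sort]
      refine Finset.prod_congr rfl fun i _ => ?_
      rw [dif_pos i.2]
      rfl
    simp_rw [hprod] at hk
    have hmk : Measurable fun x : S → ℝ≥0∞ => ∏ i, expNeg (x i) ^ k i := by fun_prop
    have hmr : Measurable (S.restrict (π := fun _ : ι => ℝ≥0∞)) := Finset.measurable_restrict S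
    have hmk' : Measurable fun x : ι → ℝ≥0∞ => ∏ i : S, expNeg (S.restrict x i) ^ k i :=
      hmk.comp hmr
    rw [lintegral_map hmk hmr, lintegral_map hmk' hG, lintegral_map hmk hmr,
      lintegral_map hmk' hG]
    exact hk
  have hcomap : mY = MeasurableSpace.comap (fun y i => h i y) MeasurableSpace.pi := by
    conv_lhs => rw [hY]
    simp only [MeasurableSpace.pi, MeasurableSpace.comap_iSup, MeasurableSpace.comap_comp]
    rfl
  refine Measure.ext fun s hs => ?_
  rw [hcomap] at hs
  obtain ⟨t, ht, rfl⟩ := hs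
  rw [← Measure.map_apply hG ht, hmap, Measure.map_apply hG ht]

/-- The evaluations which generate the `σ`-algebra of a pair of a family of measures and a number in
`[0, ∞]`. -/
def evalPair (E : Type*) [MeasurableSpace E] (D : ℕ) :
    Option (Fin D × {B : Set E // MeasurableSet B}) → (Fin D → Measure E) × ℝ≥0∞ → ℝ≥0∞
  | none, p => p.2
  | some (d, B), p => p.1 d B

/-- The evaluations generate the `σ`-algebra. -/
lemma measurableSpace_eq_iSup_evalPair (E : Type*) [MeasurableSpace E] (D : ℕ) :
    (inferInstance : MeasurableSpace ((Fin D → Measure E) × ℝ≥0∞)) =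
      ⨆ i, MeasurableSpace.comap (evalPair E D i) inferInstance := by
  refine le_antisymm ?_ (iSup_le fun i => ?_)
  · set m := ⨆ i, MeasurableSpace.comap (evalPair E D i) inferInstance with hm
    have hev : ∀ i, Measurable[m] (evalPair E D i) := fun i => by
      rw [measurable_iff_comap_le]
      exact le_iSup (fun i => MeasurableSpace.comap (evalPair E D i) inferInstance) i
    refine sup_le ?_ ?_
    · have h1 : Measurable[m] (fun p : (Fin D → Measure E) × ℝ≥0∞ => p.1) := by
        refine @measurable_pi_lambda _ _ _ m _ _ fun d => ?_
        refine @Measure.measurable_of_measurable_coe _ _ _ m _ fun B hB => ?_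
        exact hev (some (d, ⟨B, hB⟩))
      exact measurable_iff_comap_le.1 h1
    · exact measurable_iff_comap_le.1 (hev none)
  · rw [← measurable_iff_comap_le]
    rcases i with _ | ⟨d, B, hB⟩
    · exact measurable_snd
    · have h1 : Measurable fun p : (Fin D → Measure E) × ℝ≥0∞ => p.1 d :=
        (measurable_pi_apply d).comp measurable_fst
      exact (Measure.measurable_coe hB).comp h1

/-- A monomial in the variables `exp (-h)`, for evaluations `h`, is the product of an exponential of
the number and of Laplace functionals of the measures. -/
lemma exists_prod_evalPair_eq {E : Type*} [MeasurableSpace E] {D : ℕ}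
    (S : Finset (Option (Fin D × {B : Set E // MeasurableSet B})))
    (k : Option (Fin D × {B : Set E // MeasurableSet B}) → ℕ) :
    ∃ (l : ℕ) (f : Fin D → E → ℝ≥0∞), (∀ d, Measurable (f d)) ∧ ∀ p,
      ∏ i ∈ S, expNeg (evalPair E D i p) ^ k i =
        expNeg (l * p.2) * ∏ d, expNeg (∫⁻ x, f d x ∂(p.1 d)) := by
  classical
  induction S using Finset.induction_on with
  | empty => exact ⟨0, 0, fun d => measurable_zero, by simp⟩
  | insert i S hi ih =>
    obtain ⟨l, f, hf, h⟩ := ih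
    cases i with
    | none =>
      refine ⟨k none + l, f, hf, fun p => ?_⟩
      rw [Finset.prod_insert hi, h, ← mul_assoc, ← expNeg_nat_mul, ← expNeg_add, Nat.cast_add,
        add_mul]
      rfl
    | some i =>
      obtain ⟨d, B, hB⟩ := i
      set a := k (some (d, ⟨B, hB⟩))
      refine ⟨l, Function.update f d (fun x => a * B.indicator 1 x + f d x), fun d' => ?_,
        fun p => ?_⟩
      · rcases eq_or_ne d' d with rfl | hd
        · rw [Function.update_self]
          exact ((measurable_one.indicator hB).const_mul _).add (hf _)
        · rw [Function.update_of_ne hd]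
          exact hf d'
      · rw [Finset.prod_insert hi, h, mul_left_comm]
        congr 1
        rw [← Finset.mul_prod_erase _ _ (Finset.mem_univ d), ← mul_assoc,
          ← Finset.mul_prod_erase _ (fun d' => expNeg (∫⁻ x, Function.update f d
            (fun x => a * B.indicator 1 x + f d x) d' x ∂(p.1 d'))) (Finset.mem_univ d)]
        congr 1
        · rw [Function.update_self, lintegral_add_left
            ((measurable_one.indicator hB).const_mul _), lintegral_const_mul _
            (measurable_one.indicator hB), lintegral_indicator_one hB, expNeg_add, expNeg_nat_mul]
          rfl
        · refine Finset.prod_congr rfl fun d' hd' => ?_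
          rw [Function.update_of_ne (Finset.ne_of_mem_erase hd')]

/-! ### The observed units -/

/-- The weight of a trigger with label `x` on day `d` in the Laplace functional of the data. -/
def labelWeight {E : Type*} {D : ℕ} (f : Fin D → E → ℝ≥0∞) (d : ℕ) (x : E) : ℝ :=
  if h : d < D then (expNeg (f ⟨d, h⟩ x)).toReal else 1

lemma labelWeight_nonneg {E : Type*} {D : ℕ} (f : Fin D → E → ℝ≥0∞) (d : ℕ) (x : E) : 0 ≤ labelWeight f d x := by
  unfold labelWeight
  split_ifs
  · exact ENNReal.toReal_nonneg
  · exact zero_le_one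

lemma labelWeight_le_one {E : Type*} {D : ℕ} (f : Fin D → E → ℝ≥0∞) (d : ℕ) (x : E) : labelWeight f d x ≤ 1 := by
  unfold labelWeight
  split_ifs
  · exact ENNReal.toReal_le_of_le_ofReal zero_le_one (by simpa using expNeg_le_one _)
  · exact le_rfl

section Observed

variable {Ω E : Type*} [MeasurableSpace E] {w : ℕ → Ω → E} {A : ℕ → ℕ → Ω → ℕ}
  {D : ℕ} {ω : Ω}

/-- The indices of the units with at least one trigger on the first `D` days. -/
def observed (A : ℕ → ℕ → Ω → ℕ) (D : ℕ) (ω : Ω) : Set ℕ := {n | ∃ d < D, A d n ω ≠ 0}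

lemma measurableSet_finite_observed [MeasurableSpace Ω] (hA : ∀ d n, Measurable (A d n)) :
    MeasurableSet {ω | (observed A D ω).Finite} := by
  have h1 : {ω | (observed A D ω).Finite} =
      ⋃ K : ℕ, ⋂ n : ℕ, ⋂ _ : K ≤ n, ⋂ d : ℕ, ⋂ _ : d < D, A d n ⁻¹' {0} := by
    ext ω
    simp only [mem_ofPred_eq, mem_iUnion, mem_iInter, mem_preimage, mem_singleton_iff]
    constructor
    · intro h
      obtain ⟨K, hK⟩ := h.bddAbove
      refine ⟨K + 1, fun n hn d hd => ?_⟩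
      by_contra h0
      have : n ≤ K := hK ⟨d, hd, h0⟩
      omega
    · rintro ⟨K, hK⟩
      refine (Set.finite_Iio K).subset fun n hn => ?_
      obtain ⟨d, hd, h0⟩ := hn
      by_contra h
      exact h0 (hK n (not_lt.1 h) d hd)
  rw [h1]
  exact MeasurableSet.iUnion fun K => MeasurableSet.iInter fun n => MeasurableSet.iInter fun _ =>
    MeasurableSet.iInter fun d => MeasurableSet.iInter fun _ => hA d n (measurableSet_singleton 0)

lemma lintegral_data {f : E → ℝ≥0∞} (hf : Measurable f) (d : Fin D) :
    ∫⁻ x, f x ∂(data w A D ω d) = ∑' n, (A d n ω : ℝ≥0∞) * f (w n ω) := by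
  rw [data, lintegral_sum_measure]
  refine tsum_congr fun n => ?_
  rw [lintegral_smul_measure, lintegral_dirac' _ hf, smul_eq_mul]

/-- The data charge a measurable set if and only if it contains the label of an observed unit. -/
lemma exists_data_ne_zero {B : Set E} (hB : MeasurableSet B) :
    (∃ d, data w A D ω d B ≠ 0) ↔ ∃ n ∈ observed A D ω, w n ω ∈ B := by
  have h1 : ∀ d : Fin D, data w A D ω d B = ∑' n, (A d n ω : ℝ≥0∞) * B.indicator 1 (w n ω) :=
    fun d => by rw [← lintegral_indicator_one hB, lintegral_data (measurable_one.indicator hB)]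
  simp only [h1, ne_eq, ENNReal.tsum_eq_zero, not_forall, mul_eq_zero, not_or, Nat.cast_eq_zero,
    indicator_apply_eq_zero, Pi.one_apply, one_ne_zero, imp_false, not_not, observed, mem_ofPred_eq]
  constructor
  · rintro ⟨d, n, h0, hn⟩
    exact ⟨n, ⟨d, d.2, h0⟩, hn⟩
  · rintro ⟨n, ⟨d, hd, h0⟩, hn⟩
    exact ⟨⟨d, hd⟩, n, h0, hn⟩

lemma users_data [MeasurableSingletonClass E] :
    users (data w A D ω) = (fun n => w n ω) '' observed A D ω := by
  ext x
  rw [users, mem_ofPred_eq, exists_data_ne_zero (measurableSet_singleton x)]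
  rfl

lemma measurable_data [MeasurableSpace Ω] (hw : ∀ n, Measurable (w n))
    (hA : ∀ d n, Measurable (A d n)) : Measurable (data w A D) := by
  refine measurable_pi_lambda _ fun d => Measure.measurable_of_measurable_coe _ fun B hB => ?_
  have h1 : ∀ ω, data w A D ω d B = ∑' n, (A d n ω : ℝ≥0∞) * B.indicator 1 (w n ω) :=
    fun ω => by rw [← lintegral_indicator_one hB, lintegral_data (measurable_one.indicator hB)]
  simp_rw [h1]
  refine Measurable.tsum fun n => Measurable.mul ?_ ?_
  · exact measurable_from_top.comp (hA d n)
  · exact (measurable_one.indicator hB).comp (hw n)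

lemma measurable_labelWeight {f : Fin D → E → ℝ≥0∞} (hf : ∀ d, Measurable (f d)) (d : ℕ) :
    Measurable (labelWeight f d) := by
  unfold labelWeight
  split_ifs with h
  · exact (measurable_expNeg.comp (hf _)).ennreal_toReal
  · exact measurable_const

/-- The Laplace functional of the data factorizes over the units. -/
lemma prod_expNeg_lintegral_data {f : Fin D → E → ℝ≥0∞} (hf : ∀ d, Measurable (f d)) :
    ∏ d, expNeg (∫⁻ x, f d x ∂(data w A D ω d)) = ⨅ K, ∏ n ∈ Finset.range K,
      unitWeight D 1 (fun d => labelWeight f d (w n ω)) (fun d => A d n ω) := by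
  simp_rw [lintegral_data (hf _), ← expNeg_sum]
  rw [← Summable.tsum_finsetSum fun _ _ => ENNReal.summable, expNeg_tsum]
  simp_rw [expNeg_sum, expNeg_nat_mul, unitWeight, ENNReal.ofReal_one, ite_self, one_mul,
    Finset.prod_range fun d => ENNReal.ofReal (labelWeight f d (w _ ω)) ^ A d _ ω]
  refine iInf_congr fun K => Finset.prod_congr rfl fun n _ => Finset.prod_congr rfl fun d _ => ?_
  rw [labelWeight, dif_pos d.2, ENNReal.ofReal_toReal
    ((expNeg_le_one _).trans_lt ENNReal.one_lt_top).ne]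

/-- Each observed unit contributes a factor `y`. -/
lemma iInf_prod_unitWeight (hfin : (observed A D ω).Finite) {y : ℝ} (hy1 : y ≤ 1)
    {z : ℕ → ℕ → ℝ} (hz1 : ∀ n d, z n d ≤ 1) :
    ⨅ K, ∏ n ∈ Finset.range K, unitWeight D y (z n) (fun d => A d n ω) =
      ENNReal.ofReal y ^ (observed A D ω).ncard *
        ⨅ K, ∏ n ∈ Finset.range K, unitWeight D 1 (z n) (fun d => A d n ω) := by
  classical
  obtain ⟨K, hK⟩ := hfin.bddAbove
  have h0 : ∀ n, K + 1 ≤ n → ∀ d < D, A d n ω = 0 := by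
    intro n hn d hd
    by_contra h0
    have : n ≤ K := hK ⟨d, hd, h0⟩
    omega
  have h1 : ∀ y' n, K + 1 ≤ n → unitWeight D y' (z n) (fun d => A d n ω) = 1 := by
    intro y' n hn
    rw [unitWeight, if_pos (h0 n hn), one_mul]
    exact Finset.prod_eq_one fun d hd => by rw [h0 n hn d (Finset.mem_range.1 hd), pow_zero]
  rw [iInf_prod_range_eq_of_tail (fun n => unitWeight_le_one hy1 (hz1 n) _) (h1 y),
    iInf_prod_range_eq_of_tail (fun n => unitWeight_le_one le_rfl (hz1 n) _) (h1 1)]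
  simp only [unitWeight, ENNReal.ofReal_one, ite_self, one_mul, Finset.prod_mul_distrib]
  congr 1
  rw [Finset.prod_ite, Finset.prod_const_one, one_mul, Finset.prod_const,
    ← Set.ncard_coe_finset]
  congr 2
  ext n
  simp only [Finset.coe_filter, Finset.mem_range, not_forall, mem_ofPred_eq, observed, exists_prop]
  refine ⟨fun h => h.2, fun h => ⟨?_, h⟩⟩
  have : n ≤ K := hK h
  omega

/-- Infinitely many observed units make the product of the weights vanish. -/
lemma iInf_prod_unitWeight_eq_zero (hinf : ¬ (observed A D ω).Finite) {y : ℝ}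
    (hy1 : y < 1) {z : ℕ → ℕ → ℝ} (hz1 : ∀ n d, z n d ≤ 1) :
    ⨅ K, ∏ n ∈ Finset.range K, unitWeight D y (z n) (fun d => A d n ω) = 0 := by
  classical
  have h1 : Tendsto (fun k : ℕ => ENNReal.ofReal y ^ k) atTop (𝓝 0) :=
    ENNReal.tendsto_pow_atTop_nhds_zero_of_lt_one (by simpa using hy1)
  refine le_antisymm (ge_of_tendsto' h1 fun k => ?_) zero_le
  obtain ⟨S, hS, hk⟩ := Set.Infinite.exists_subset_card_eq hinf k
  refine (iInf_le _ (S.sup id + 1)).trans ?_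
  have hSr : S ⊆ Finset.range (S.sup id + 1) := fun n hn =>
    Finset.mem_range.2 (Nat.lt_succ_of_le (Finset.le_sup (f := id) hn))
  refine (Finset.prod_le_prod_of_subset_of_le_one' hSr fun n _ _ =>
    unitWeight_le_one hy1.le (hz1 n) _).trans ?_
  rw [← hk, ← Finset.prod_const]
  refine Finset.prod_le_prod' fun n hn => ?_
  obtain ⟨d, hd, h0⟩ := hS hn
  rw [unitWeight, if_neg fun h => h0 (h d hd)]
  exact mul_le_of_le_one_right' (Finset.prod_le_one' fun d _ =>
    pow_le_one₀ zero_le (ENNReal.ofReal_le_one.2 (hz1 n d)))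

end Observed

/-! ### A measurable version of the number of users -/

section Count

variable (E : Type*) [MeasurableSpace E] [MeasurableSpace.CountablyGenerated E]

/-- The cells of the partitions generated by the first `m` members of a countable generating
family. -/
def cell (m : ℕ) (b : Fin m → Bool) : Set E :=
  {x | ∀ i : Fin m, MeasurableSpace.mapNatBool E x i = b i}

lemma measurableSet_cell (m : ℕ) (b : Fin m → Bool) : MeasurableSet (cell E m b) := by
  have : cell E m b = ⋂ i : Fin m, {x | MeasurableSpace.mapNatBool E x i = b i} := by
    ext; simp [cell]
  rw [this]
  exact MeasurableSet.iInter fun i => ((measurable_pi_apply (i : ℕ)).comp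
    (MeasurableSpace.measurable_mapNatBool E)) (measurableSet_singleton (b i))

open Classical in
/-- The number of cells of level `m` which are charged by the data. -/
def cellCount {D : ℕ} (m : ℕ) (z : Fin D → Measure E) : ℕ :=
  (Finset.univ.filter fun b : Fin m → Bool => ∃ d, z d (cell E m b) ≠ 0).card

variable {E}

/-- A measurable function of the data which agrees with `numUsers` when there are finitely many
users and the data charge only sets which contain a user. The floor turns the supremum, which is
then a natural number, into an element of `ℕ`. -/
def userCount {D : ℕ} (z : Fin D → Measure E) : ℕ :=
  ⌊(⨆ m, (cellCount E m z : ℝ≥0∞)).toReal⌋₊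

lemma measurable_userCount {D : ℕ} :
    Measurable (userCount : (Fin D → Measure E) → ℕ) := by
  classical
  refine Nat.measurable_floor.comp (Measurable.ennreal_toReal (Measurable.iSup fun m => ?_))
  have h1 : ∀ z : Fin D → Measure E, (cellCount E m z : ℝ≥0∞) =
      ∑ b : Fin m → Bool, if ∃ d, z d (cell E m b) ≠ 0 then 1 else 0 := by
    intro z
    rw [cellCount, Finset.sum_boole]
  simp_rw [h1]
  refine Finset.measurable_sum _ fun b _ => Measurable.ite ?_ measurable_const measurable_const
  have h2 : {z : Fin D → Measure E | ∃ d, z d (cell E m b) ≠ 0} =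
      ⋃ d, (fun z : Fin D → Measure E => z d (cell E m b)) ⁻¹' {0}ᶜ := by
    ext; simp
  rw [h2]
  refine MeasurableSet.iUnion fun d => ?_
  have h3 : Measurable fun z : Fin D → Measure E => z d (cell E m b) :=
    (Measure.measurable_coe (measurableSet_cell E m b)).comp (measurable_pi_apply d)
  exact h3 (measurableSet_singleton 0).compl

/-- The number of charged cells increases to the number of users. -/
lemma userCount_eq [MeasurableSpace.SeparatesPoints E] {D : ℕ} {z : Fin D → Measure E}
    (hfin : (users z).Finite)
    (hz : ∀ B, MeasurableSet B → ((∃ d, z d B ≠ 0) ↔ ∃ x ∈ users z, x ∈ B)) :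
    userCount z = numUsers z := by
  classical
  set code := MeasurableSpace.mapNatBool E with hcode
  set U := hfin.toFinset with hU
  have hcard : numUsers z = U.card := by rw [numUsers, Set.ncard_eq_toFinset_card _ hfin]
  have himage : ∀ m, cellCount E m z = (U.image fun x (i : Fin m) => code x i).card := by
    intro m
    rw [cellCount]
    congr 1
    ext b
    rw [Finset.mem_filter, hz _ (measurableSet_cell E m b), Finset.mem_image]
    simp only [Finset.mem_univ, true_and, hU, Set.Finite.mem_toFinset, cell, mem_ofPred_eq,
      funext_iff]
    rfl
  -- finitely many points are separated by finitely many members of the generating family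
  obtain ⟨m, hm⟩ : ∃ m, Set.InjOn (fun x (i : Fin m) => code x i) U := by
    have h1 : ∀ p : E × E, ∃ n, p.1 ≠ p.2 → code p.1 n ≠ code p.2 n := by
      intro p
      by_cases hp : p.1 = p.2
      · exact ⟨0, fun h => absurd hp h⟩
      · obtain ⟨n, hn⟩ := Function.ne_iff.1
          ((MeasurableSpace.injective_mapNatBool E).ne hp)
        exact ⟨n, fun _ => hn⟩
    choose g hg using h1
    refine ⟨(U ×ˢ U).sup g + 1, fun x hx y hy hxy => ?_⟩
    by_contra hne
    have h2 : g (x, y) ≤ (U ×ˢ U).sup g := Finset.le_sup (Finset.mk_mem_product hx hy)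
    exact hg (x, y) hne (congrFun hxy ⟨g (x, y), Nat.lt_succ_of_le h2⟩)
  have hsup : ⨆ m, (cellCount E m z : ℝ≥0∞) = U.card := by
    refine le_antisymm (iSup_le fun m => ?_) ?_
    · rw [himage]
      exact_mod_cast Finset.card_image_le
    · refine le_trans ?_ (le_iSup _ m)
      rw [himage, Finset.card_image_of_injOn hm]
  rw [userCount, hsup, hcard]
  simp

end Count

/-! ### The posterior of the largest jump -/

section Posterior

variable {Ω₀ Ω E : Type*} [MeasurableSpace Ω₀] [MeasurableSpace Ω] [MeasurableSpace E]
  {σ β c r : ℝ} {Q : Measure Ω₀} [IsProbabilityMeasure Q] {Δ : ℕ → Ω₀ → ℝ}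
  {P₀ : Measure E} [IsProbabilityMeasure P₀] {P : Measure Ω} [IsProbabilityMeasure P]
  {T : Ω → ℝ} {θ : ℕ → Ω → ℝ} {w : ℕ → Ω → E} {A : ℕ → ℕ → Ω → ℕ} {D : ℕ}

lemma seenMass_one (hσ : σ ∈ Ioo (0 : ℝ) 1) (hr : 0 ≤ r) :
    seenMass σ P₀ r D (fun _ _ => 1) = ENNReal.ofReal (psi σ r 0 D) := by
  rw [← lintegral_one_sub_unseenProb hσ hr, seenMass]
  simp [meanGen, nbGen_one]

lemma psi_nonneg (hσ : σ ∈ Ioo (0 : ℝ) 1) (hr : 0 ≤ r) : 0 ≤ psi σ r 0 D :=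
  (lintegral_one_sub_rpow hσ (mul_nonneg hr (Nat.cast_nonneg D))).1

/-- Almost surely, only finitely many units are observed: the generating function of their number
tends to `1` at `1`. -/
lemma IsModel.ae_finite_observed (hσ : σ ∈ Ioo (0 : ℝ) 1) (hβ : 0 < β) (hc : 0 < c) (hr : 0 < r)
    (hΔ : IsStableJumps σ Q Δ) (h : IsModel σ β c r (scaledJumpsKernel Q Δ) P₀ P T θ w A) :
    ∀ᵐ ω ∂P, (observed A D ω).Finite := by
  have hψ := psi_nonneg (D := D) hσ hr.le
  have h1 : ∀ y : ℝ, 0 ≤ y → y < 1 →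
      ENNReal.ofReal ((β / (β + (0 + (psi σ r 0 D - y * psi σ r 0 D)))) ^ (c + 1)) ≤
        P {ω | (observed A D ω).Finite} := by
    intro y hy0 hy1
    have h2 := h.lintegral_unitWeight hσ hβ hc hr hΔ (D := D) (ζ := fun _ _ => 1)
      (fun _ => measurable_const) (fun _ _ => zero_le_one) (fun _ _ => le_rfl) hy0 hy1.le
      (le_refl 0)
    rw [seenMass_one hσ hr.le, ENNReal.toReal_ofReal hψ] at h2
    rw [← h2]
    refine le_trans (lintegral_mono fun ω => ?_)
      (lintegral_indicator_one_le {ω | (observed A D ω).Finite})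
    by_cases hω : (observed A D ω).Finite
    · rw [indicator_of_mem (by exact hω), Pi.one_apply]
      exact mul_le_one' (expNeg_le_one _) (iInf_prod_range_le_one _)
    · rw [iInf_prod_unitWeight_eq_zero hω hy1 (fun _ _ => le_rfl), mul_zero]
      exact zero_le
  have h3 : Tendsto (fun y : ℝ => ENNReal.ofReal
      ((β / (β + (0 + (psi σ r 0 D - y * psi σ r 0 D)))) ^ (c + 1))) (𝓝[<] 1)
      (𝓝 (ENNReal.ofReal ((β / (β + (0 + (psi σ r 0 D - 1 * psi σ r 0 D)))) ^ (c + 1)))) := by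
    refine (ENNReal.continuous_ofReal.continuousAt.comp ?_).tendsto.mono_left nhdsWithin_le_nhds
    refine ContinuousAt.rpow_const (ContinuousAt.div (by fun_prop) (by fun_prop) ?_) ?_
    · simpa using hβ.ne'
    · exact Or.inr (by linarith)
  have h4 := le_of_tendsto h3 (b := P {ω | (observed A D ω).Finite}) (by
    filter_upwards [Ioo_mem_nhdsLT (zero_lt_one' ℝ)] with y hy using h1 y hy.1.le hy.2)
  rw [show β / (β + (0 + (psi σ r 0 D - 1 * psi σ r 0 D))) = 1 by
    rw [one_mul, sub_self, add_zero, add_zero, div_self hβ.ne'], Real.one_rpow,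
    ENNReal.ofReal_one] at h4
  rw [ae_iff]
  exact (prob_compl_eq_zero_iff (measurableSet_finite_observed h.measurable_count)).2
    (le_antisymm prob_le_one h4)

/-- Labels drawn independently from a diffuse law are almost surely distinct. -/
lemma IsModel.ae_injective_label [MeasurableSpace.CountablyGenerated E]
    [MeasurableSpace.SeparatesPoints E] [NullSingletonClass P₀] {G : Kernel ℝ (ℕ → ℝ)}
    (h : IsModel σ β c r G P₀ P T θ w A) :
    ∀ᵐ ω ∂P, Function.Injective fun n => w n ω := by
  have hdiag : MeasurableSet (diagonal E) := by
    have h0 : Measurable (MeasurableSpace.mapNatBool E) := MeasurableSpace.measurable_mapNatBool E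
    have h1 : diagonal E = {p : E × E | MeasurableSpace.mapNatBool E p.1 =
        MeasurableSpace.mapNatBool E p.2} := by
      ext p
      exact (MeasurableSpace.injective_mapNatBool E).eq_iff.symm
    rw [h1]
    exact measurableSet_eq_fun (h0.comp measurable_fst) (h0.comp measurable_snd)
  have h1 : (P₀.prod P₀) (diagonal E) = 0 := by
    rw [Measure.prod_apply hdiag, lintegral_eq_zero_iff (measurable_measure_prodMk_left hdiag)]
    refine ae_of_all _ fun x => ?_
    change P₀ (Prod.mk x ⁻¹' diagonal E) = 0
    have : Prod.mk x ⁻¹' diagonal E = {x} := by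
      ext y
      simp [eq_comm]
    rw [this, measure_singleton]
  have hw : Measurable fun ω n => w n ω := measurable_pi_lambda _ h.measurable_label
  have h2 : ∀ p : {p : ℕ × ℕ // p.1 ≠ p.2}, ∀ᵐ ω ∂P, w p.1.1 ω ≠ w p.1.2 ω := by
    intro p
    have h3 := Measure.infinitePi_map_eval_prod (P := fun _ : ℕ => P₀) p.2
    rw [← h.law_labels, Measure.map_map (by fun_prop) hw] at h3
    have h4 : ∀ᵐ q ∂(P₀.prod P₀), q.1 ≠ q.2 := by
      rw [ae_iff]
      simpa [diagonal] using h1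
    rw [← h3] at h4
    exact ae_of_ae_map ((h.measurable_label _).prodMk (h.measurable_label _)).aemeasurable h4
  filter_upwards [ae_all_iff.2 h2] with ω hω m n hmn
  by_contra hne
  exact hω ⟨(m, n), hne⟩ hmn

/-- As the labels are distinct, users correspond to observed units. -/
lemma IsModel.ae_users [MeasurableSpace.CountablyGenerated E]
    [MeasurableSpace.SeparatesPoints E] [NullSingletonClass P₀]
    (hσ : σ ∈ Ioo (0 : ℝ) 1) (hβ : 0 < β) (hc : 0 < c) (hr : 0 < r)
    (hΔ : IsStableJumps σ Q Δ) (h : IsModel σ β c r (scaledJumpsKernel Q Δ) P₀ P T θ w A) :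
    ∀ᵐ ω ∂P, (users (data w A D ω)).Finite ∧ (observed A D ω).Finite ∧
      numUsers (data w A D ω) = (observed A D ω).ncard ∧
      userCount (data w A D ω) = (observed A D ω).ncard := by
  have : MeasurableSingletonClass E := MeasurableSpace.measurableSingletonClass_of_countablySeparated
  filter_upwards [h.ae_finite_observed hσ hβ hc hr hΔ (D := D), h.ae_injective_label] with ω hω hinj
  have hu : (users (data w A D ω)).Finite := by
    rw [users_data]
    exact hω.image _
  have hN : numUsers (data w A D ω) = (observed A D ω).ncard := by
    rw [numUsers, users_data, Set.ncard_image_of_injective _ hinj]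
  refine ⟨hu, hω, hN, ?_⟩
  rw [← hN]
  refine userCount_eq hu fun B hB => ?_
  rw [exists_data_ne_zero hB, users_data]
  simp

/-- Weighting with `exp (-l T ^ (-σ))` has the same effect on the law of the data as discounting
each observed user by the factor `(β + ψ) / (β + ψ + l)`. -/
lemma IsModel.lintegral_expNeg_mul_data [MeasurableSpace.CountablyGenerated E]
    [MeasurableSpace.SeparatesPoints E] [NullSingletonClass P₀]
    (hσ : σ ∈ Ioo (0 : ℝ) 1) (hβ : 0 < β) (hc : 0 < c) (hr : 0 < r)
    (hΔ : IsStableJumps σ Q Δ) (h : IsModel σ β c r (scaledJumpsKernel Q Δ) P₀ P T θ w A)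
    {f : Fin D → E → ℝ≥0∞} (hf : ∀ d, Measurable (f d)) {l : ℝ} (hl : 0 ≤ l) :
    ∫⁻ ω, expNeg (ENNReal.ofReal l * ENNReal.ofReal (T ω ^ (-σ))) *
        ∏ d, expNeg (∫⁻ x, f d x ∂(data w A D ω d)) ∂P =
      ∫⁻ ω, ENNReal.ofReal (((β + psi σ r 0 D) / (β + psi σ r 0 D + l)) ^
        (userCount (data w A D ω) + c + 1)) *
        ∏ d, expNeg (∫⁻ x, f d x ∂(data w A D ω d)) ∂P := by
  have hψ := psi_nonneg (D := D) hσ hr.le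
  set ψ := psi σ r 0 D
  set y := (β + ψ) / (β + ψ + l) with hy
  have hpos : 0 < β + ψ + l := by linarith
  have hy0 : 0 < y := div_pos (by linarith) hpos
  have hy1 : y ≤ 1 := (div_le_one hpos).2 (by linarith)
  have hζ := measurable_labelWeight hf
  have hζ0 := labelWeight_nonneg f
  have hζ1 := labelWeight_le_one f
  have hρ : (seenMass σ P₀ r D (labelWeight f)).toReal ≤ ψ :=
    ENNReal.toReal_le_of_le_ofReal hψ (seenMass_le hσ hr.le hζ hζ0 hζ1)
  set ρ := (seenMass σ P₀ r D (labelWeight f)).toReal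
  have hρ0 : 0 ≤ ρ := ENNReal.toReal_nonneg
  have hleft := h.lintegral_unitWeight (D := D) hσ hβ hc hr hΔ hζ hζ0 hζ1 zero_le_one le_rfl hl
  have hright := h.lintegral_unitWeight (D := D) hσ hβ hc hr hΔ hζ hζ0 hζ1 hy0.le hy1 (le_refl 0)
  simp_rw [← prod_expNeg_lintegral_data hf] at hleft
  rw [hleft]
  have h1 : ∀ᵐ ω ∂P, ENNReal.ofReal (y ^ (userCount (data w A D ω) + c + 1)) *
      ∏ d, expNeg (∫⁻ x, f d x ∂(data w A D ω d)) = ENNReal.ofReal (y ^ (c + 1)) *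
        (expNeg (ENNReal.ofReal 0 * ENNReal.ofReal (T ω ^ (-σ))) * ⨅ K, ∏ n ∈ Finset.range K,
          unitWeight D y (fun d => labelWeight f d (w n ω)) (fun d => A d n ω)) := by
    filter_upwards [h.ae_users hσ hβ hc hr hΔ (D := D)] with ω hω
    rw [iInf_prod_unitWeight hω.2.1 hy1 (fun n d => hζ1 d (w n ω)),
      ← prod_expNeg_lintegral_data hf, hω.2.2.2, ENNReal.ofReal_zero, zero_mul, expNeg_zero,
      one_mul, ← mul_assoc, ← ENNReal.ofReal_pow hy0.le, ← ENNReal.ofReal_mul (by positivity),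
      add_assoc, Real.rpow_add hy0, Real.rpow_natCast, mul_comm (y ^ (c + 1))]
  rw [lintegral_congr_ae h1, lintegral_const_mul' _ _ ENNReal.ofReal_ne_top, hright,
    ← ENNReal.ofReal_mul (by positivity)]
  -- the identity behind this is `y * (β + l + ψ - ρ) = β + ψ - y * ρ`
  have h2 : 0 < β + (0 + (ψ - y * ρ)) := by nlinarith
  have h3 : 0 < β + (l + (ψ - 1 * ρ)) := by linarith
  rw [← Real.mul_rpow hy0.le (by positivity)]
  congr 2
  rw [hy, div_mul_div_comm, div_eq_div_iff h3.ne' (by rw [← hy]; positivity)]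
  field_simp
  ring

/-- The kernel which sends the data to the law `Gamma(N + a, b)`, where `N` is the number of users,
regarded as a measure on `[0, ∞]`. -/
def posteriorKernel (E : Type*) [MeasurableSpace E] [MeasurableSpace.CountablyGenerated E]
    (D : ℕ) (a b : ℝ) : Kernel (Fin D → Measure E) ℝ≥0∞ :=
  Kernel.comap ⟨fun n : ℕ => (gammaMeasure (n + a) b).map ENNReal.ofReal,
    measurable_from_top⟩ userCount measurable_userCount

lemma posteriorKernel_apply [MeasurableSpace.CountablyGenerated E] (a b : ℝ)
    (z : Fin D → Measure E) : posteriorKernel E D a b z =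
      (gammaMeasure (userCount z + a) b).map ENNReal.ofReal := rfl

lemma isMarkovKernel_posteriorKernel [MeasurableSpace.CountablyGenerated E] {a b : ℝ}
    (ha : 0 < a) (hb : 0 < b) : IsMarkovKernel (posteriorKernel E D a b) := by
  refine ⟨fun z => ?_⟩
  rw [posteriorKernel_apply]
  have := isProbabilityMeasure_gammaMeasure (a := userCount z + a) (r := b) (by positivity) hb
  exact Measure.isProbabilityMeasure_map (by fun_prop)

/-- The joint law of the data and of `T ^ (-σ)`. -/
lemma IsModel.map_data_prodMk [MeasurableSpace.CountablyGenerated E]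
    [MeasurableSpace.SeparatesPoints E] [NullSingletonClass P₀]
    (hσ : σ ∈ Ioo (0 : ℝ) 1) (hβ : 0 < β) (hc : 0 < c) (hr : 0 < r)
    (hΔ : IsStableJumps σ Q Δ) (h : IsModel σ β c r (scaledJumpsKernel Q Δ) P₀ P T θ w A) :
    P.map (fun ω => (data w A D ω, ENNReal.ofReal (T ω ^ (-σ)))) =
      P.map (data w A D) ⊗ₘ posteriorKernel E D (c + 1) (β + psi σ r 0 D) := by
  have hb : 0 < β + psi σ r 0 D := by linarith [psi_nonneg (D := D) hσ hr.le]
  have hZ : Measurable (data w A D) := measurable_data h.measurable_label h.measurable_count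
  have hV : Measurable fun ω => ENNReal.ofReal (T ω ^ (-σ)) :=
    (h.measurable_jump.pow_const _).ennreal_ofReal
  have := isMarkovKernel_posteriorKernel (E := E) (D := D) (by linarith : 0 < c + 1) hb
  have : IsProbabilityMeasure (P.map (data w A D)) :=
    Measure.isProbabilityMeasure_map hZ.aemeasurable
  refine ext_of_lintegral_expNeg (measurableSpace_eq_iSup_evalPair E D) fun S k => ?_
  obtain ⟨l, f, hf, hprod⟩ := exists_prod_evalPair_eq S k
  simp_rw [hprod]
  have hW : Measurable fun z : Fin D → Measure E => ∏ d, expNeg (∫⁻ x, f d x ∂(z d)) :=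
    Finset.measurable_prod _ fun d _ => measurable_expNeg.comp
      ((Measure.measurable_lintegral (hf d)).comp (measurable_pi_apply d))
  have hF : Measurable fun p : (Fin D → Measure E) × ℝ≥0∞ =>
      expNeg (l * p.2) * ∏ d, expNeg (∫⁻ x, f d x ∂(p.1 d)) :=
    (measurable_expNeg.comp (measurable_snd.const_mul _)).mul (hW.comp measurable_fst)
  rw [lintegral_map hF (hZ.prodMk hV), Measure.lintegral_compProd hF]
  have h1 := h.lintegral_expNeg_mul_data hσ hβ hc hr hΔ hf (Nat.cast_nonneg (α := ℝ) l)
  rw [ENNReal.ofReal_natCast] at h1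
  rw [h1, ← lintegral_map (f := fun z => ENNReal.ofReal (((β + psi σ r 0 D) /
    (β + psi σ r 0 D + l)) ^ (userCount z + c + 1)) * ∏ d, expNeg (∫⁻ x, f d x ∂(z d))) ?_ hZ]
  · refine lintegral_congr fun z => ?_
    dsimp only
    rw [lintegral_mul_const _ (by fun_prop), posteriorKernel_apply,
      lintegral_map (by fun_prop) ENNReal.measurable_ofReal, add_assoc (userCount z : ℝ),
      ← lintegral_expNeg_gammaMeasure (by positivity) hb (Nat.cast_nonneg l),
      ENNReal.ofReal_natCast]
  · refine Measurable.mul ?_ hW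
    exact (measurable_from_top (f := fun n : ℕ => ENNReal.ofReal (((β + psi σ r 0 D) /
      (β + psi σ r 0 D + l)) ^ (n + c + 1)))).comp measurable_userCount

/-- The posterior law of a function of `T ^ (-σ)`. -/
lemma IsModel.condDistrib_data [MeasurableSpace.CountablyGenerated E]
    [MeasurableSpace.SeparatesPoints E] [NullSingletonClass P₀]
    (hσ : σ ∈ Ioo (0 : ℝ) 1) (hβ : 0 < β) (hc : 0 < c) (hr : 0 < r)
    (hΔ : IsStableJumps σ Q Δ) (h : IsModel σ β c r (scaledJumpsKernel Q Δ) P₀ P T θ w A)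
    {g : ℝ → ℝ} (hg : Measurable g) :
    ∀ᵐ ω ∂P, condDistrib (fun ω => g (T ω ^ (-σ))) (data w A D) P (data w A D ω) =
      (gammaMeasure (numUsers (data w A D ω) + c + 1) (β + psi σ r 0 D)).map g := by
  have hb : 0 < β + psi σ r 0 D := by linarith [psi_nonneg (D := D) hσ hr.le]
  have hZ : Measurable (data w A D) := measurable_data h.measurable_label h.measurable_count
  have hV : Measurable fun ω => ENNReal.ofReal (T ω ^ (-σ)) :=
    (h.measurable_jump.pow_const _).ennreal_ofReal
  have := isMarkovKernel_posteriorKernel (E := E) (D := D) (by linarith : 0 < c + 1) hb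
  have hgt : Measurable fun x : ℝ≥0∞ => g x.toReal := hg.comp ENNReal.measurable_toReal
  have h1 := condDistrib_ae_eq_of_measure_eq_compProd (data w A D) hV.aemeasurable
    (h.map_data_prodMk hσ hβ hc hr hΔ (D := D))
  have h2 := condDistrib_comp (mβ := MeasurableSpace.pi) (μ := P) (data w A D) hV.aemeasurable hgt
  have h3 : (fun ω => g (T ω ^ (-σ))) =ᵐ[P]
      (fun x : ℝ≥0∞ => g x.toReal) ∘ fun ω => ENNReal.ofReal (T ω ^ (-σ)) := by
    filter_upwards [h.ae_jump_pos hσ.1] with ω hω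
    rw [Function.comp_apply, ENNReal.toReal_ofReal (Real.rpow_nonneg hω.le _)]
  rw [condDistrib_congr_left h3]
  filter_upwards [ae_of_ae_map hZ.aemeasurable h1, ae_of_ae_map hZ.aemeasurable h2,
    h.ae_users hσ hβ hc hr hΔ (D := D)] with ω h1 h2 h4
  rw [h2, Kernel.map_apply _ hgt, h1, posteriorKernel_apply, h4.2.2.2, ← h4.2.2.1, ← add_assoc,
    Measure.map_map hgt ENNReal.measurable_ofReal]
  refine Measure.map_congr ?_
  filter_upwards [ae_gammaMeasure_pos _ _] with v hv
  rw [Function.comp_apply, ENNReal.toReal_ofReal hv.le]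

end Posterior

end SBSP

end

theorem mainTheorem5
    {Ω₀ Ω E : Type*} [MeasurableSpace Ω₀] [MeasurableSpace Ω]
    [TopologicalSpace E] [PolishSpace E] [MeasurableSpace E] [BorelSpace E]
    (σ β c r : ℝ) (hσ : σ ∈ Set.Ioo (0 : ℝ) 1) (hβ : 0 < β) (hc : 0 < c) (hr : 0 < r)
    -- the sorted jumps of the stable process
    (Q : Measure Ω₀) [IsProbabilityMeasure Q] (Δ : ℕ → Ω₀ → ℝ) (hΔ : SBSP.IsStableJumps σ Q Δ)
    -- the diffuse law of the labels
    (P₀ : Measure E) [IsProbabilityMeasure P₀] [NullSingletonClass P₀]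
    -- the model
    (P : Measure Ω) [IsProbabilityMeasure P]
    (T : Ω → ℝ) (θ : ℕ → Ω → ℝ) (w : ℕ → Ω → E) (A : ℕ → ℕ → Ω → ℕ)
    (hmodel : SBSP.IsModel σ β c r (SBSP.scaledJumpsKernel Q Δ) P₀ P T θ w A)
    -- the number of observed days
    (D : ℕ) :
    ∀ᵐ ω ∂P,
      (SBSP.users (SBSP.data w A D ω)).Finite ∧
      (∃ C : ℝ, 0 < C ∧
        condDistrib T (SBSP.data w A D) P (SBSP.data w A D ω) =
          (volume.restrict (Set.Ioi 0)).withDensity (fun η => ENNReal.ofReal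
            (C * (Real.exp (-(η ^ (-σ) * (β + SBSP.psi σ r 0 D))) *
              η ^ (-σ * (SBSP.numUsers (SBSP.data w A D ω) + c + 1) - 1))))) ∧
      condDistrib (fun ω' => T ω' ^ (-σ)) (SBSP.data w A D) P (SBSP.data w A D ω) =
        gammaMeasure (SBSP.numUsers (SBSP.data w A D ω) + c + 1) (β + SBSP.psi σ r 0 D) := by
  have hb : 0 < β + SBSP.psi σ r 0 D := by linarith [SBSP.psi_nonneg (D := D) hσ hr.le]
  -- the jump is recovered from its power, and the density of its law from that of the gamma law
  have hT : (fun ω => (T ω ^ (-σ)) ^ (-1 / σ)) =ᵐ[P] T := by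
    filter_upwards [hmodel.ae_jump_pos hσ.1] with ω hω
    have hσ0 : σ ≠ 0 := hσ.1.ne'
    rw [← Real.rpow_mul hω.le, show -σ * (-1 / σ) = 1 by field_simp, Real.rpow_one]
  have hg : Measurable fun v : ℝ => v ^ (-1 / σ) := by fun_prop
  filter_upwards [hmodel.ae_users hσ hβ hc hr hΔ (D := D),
    hmodel.condDistrib_data hσ hβ hc hr hΔ (D := D) hg,
    hmodel.condDistrib_data hσ hβ hc hr hΔ (D := D) measurable_id] with ω h1 h2 h3
  rw [condDistrib_congr_left hT, SBSP.map_gammaMeasure_rpow hσ.1] at h2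
  rw [Measure.map_id] at h3
  set a : ℝ := SBSP.numUsers (SBSP.data w A D ω) + c + 1 with ha
  have ha0 : 0 < a := by positivity
  refine ⟨h1.1, ⟨(β + SBSP.psi σ r 0 D) ^ a / Real.Gamma a * σ, ?_, h2⟩, h3⟩
  have hG := Real.Gamma_pos_of_pos ha0
  have := hσ.1
  positivity
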